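/- **Conventions.** An operator algebra with masa $(\mathcal A,\mathcal C)$ is a norm closed (not necessarily self-adjoint or unital) subalgebra $\mathcal A$ of a $C^*$-algebra together with a maximal abelian self-adjoint subalgebra $\mathcal C$ of the generated $C^*$-algebra $C^*(\mathcal A)$ such that $\mathcal C\subseteq\mathcal A$. Write $N_{\mathcal C}(\mathcal A)$ for the set of partial isometries $v\in\mathcal A$ such that $v^*cv\in\mathcal C$ and $vcv^*\in\mathcal C$ for all $c\in\mathcal C$. An algebra homomorphism $\phi:\mathcal A_1\to\mathcal A_2$ is *star extendible* if it is the restriction of a $*$-homomorphism $C^*(\mathcal A_1)\to C^*(\mathcal A_2)$, and it is *regular* (with respect to masas $\mathcal C_1,\mathcal C_2$) if $\phi(N_{\mathcal C_1}(\mathcal A_1))\subseteq N_{\mathcal C_2}(\mathcal A_2)$. A *digraph algebra with masa* $(\mathcal B,\mathcal C_{\mathcal B})$ consists, for a reflexive transitive digraph on $\{1,\dots,n\}$, of the algebra $\mathcal B\subseteq M_n(\mathbb C)$ spanned by the matrix units $e_{i,j}$ with $(i,j)$ an edge, and the diagonal algebra $\mathcal C_{\mathcal B}$. (The trivial case $n=0$,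 $\mathcal B=\{0\}$, is allowed.) The pair $(\mathcal A,\mathcal C)$ is a *regular limit of digraph algebras* if there are digraph algebras with masas $(\mathcal A_k,\mathcal C_k)$, $k\in\mathbb N$, regular star extendible injections $\phi_k:\mathcal A_k\to\mathcal A_{k+1}$, and star extendible injections $\psi_k:\mathcal A_k\to\mathcal A$ with $\psi_{k+1}\circ\phi_k=\psi_k$ for all $k$, such that $\mathcal A=\overline{\bigcup_k\psi_k(\mathcal A_k)}$ and $\mathcal C=\overline{\bigcup_k\psi_k(\mathcal C_k)}$. **Theorem 3.11.** Let $(\mathcal A,\mathcal C_{\mathcal A})$ be a separable operator algebra with masa. Then $(\mathcal A,\mathcal C_{\mathcal A})$ is a regular limit of digraph algebras if and only if for every $\varepsilon>0$ and every finite subset $\mathcal S\subseteq\mathcal A$ there exist a digraph algebra with masa $(\mathcal B,\mathcal C_{\mathcal B})$ and a regular star extendible injection $\phi:\mathcal B\to\mathcal A$ (regular with respect to $\mathcal C_{\mathcal B}$ and $\mathcal C_{\mathcal A}$) such that $\operatorname{dist}(s,\phi(\mathcal B))<\varepsilon$ for every $s\in\mathcal S$. -/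

import Mathlib

universe u v

section OperatorAlgebras

variable {D : Type u} [NonUnitalCStarAlgebra D] {E : Type v} [NonUnitalCStarAlgebra E]

/-- The C*-algebra `C*(A)` generated by a subalgebra `A` of a C*-algebra `D`. -/
noncomputable def generatedCStar (A : NonUnitalSubalgebra ℂ D) : NonUnitalStarSubalgebra ℂ D :=
  (NonUnitalStarAlgebra.adjoin ℂ (A : Set D)).topologicalClosure

lemma subset_generatedCStar (A : NonUnitalSubalgebra ℂ D) {a : D} (ha : a ∈ A) :
    a ∈ generatedCStar A :=
  NonUnitalStarSubalgebra.le_topologicalClosure _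
    (NonUnitalStarAlgebra.subset_adjoin ℂ (A : Set D) ha)

/-- `C` is a masa of the C*-subalgebra `M`: it is maximal among the abelian self-adjoint
subalgebras of `M`. -/
def IsMasa (M C : NonUnitalStarSubalgebra ℂ D) : Prop :=
  Maximal (fun S : NonUnitalStarSubalgebra ℂ D =>
    S ≤ M ∧ ∀ x ∈ S, ∀ y ∈ S, x * y = y * x) C

/-- `(A, C)` is an operator algebra with masa: `A` is a norm closed (not necessarily
self-adjoint, not necessarily unital) subalgebra of the C*-algebra `D`, and `C ⊆ A` is a masa
of the C*-algebra generated by `A`. -/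
structure IsOperatorAlgebraWithMasa (A : NonUnitalSubalgebra ℂ D)
    (C : NonUnitalStarSubalgebra ℂ D) : Prop where
  isClosed : IsClosed (A : Set D)
  masa_le : ∀ c ∈ C, c ∈ A
  isMasa : IsMasa (generatedCStar A) C

/-- `N_C(A)`: the partial isometries `v ∈ A` with `v* c v ∈ C` and `v c v* ∈ C` for all `c ∈ C`. -/
def normalisers (A : NonUnitalSubalgebra ℂ D) (C : NonUnitalStarSubalgebra ℂ D) : Set D :=
  {w | w ∈ A ∧ w * star w * w = w ∧ ∀ c ∈ C, star w * c * w ∈ C ∧ w * c * star w ∈ C}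

/-- An algebra homomorphism `φ : A → B` is star extendible if it is the restriction of a
*-homomorphism `C*(A) → C*(B)`. -/
def IsStarExtendible {A : NonUnitalSubalgebra ℂ D} {B : NonUnitalSubalgebra ℂ E}
    (φ : A →ₙₐ[ℂ] B) : Prop :=
  ∃ Φ : generatedCStar A →⋆ₙₐ[ℂ] generatedCStar B,
    ∀ a : A, (Φ ⟨(a : D), subset_generatedCStar A a.2⟩ : E) = (φ a : E)

/-- `φ : A → B` is regular with respect to `C_A`, `C_B`: it maps `N_{C_A}(A)` into `N_{C_B}(B)`. -/
def IsRegularMap {A : NonUnitalSubalgebra ℂ D} (CA : NonUnitalStarSubalgebra ℂ D)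
    {B : NonUnitalSubalgebra ℂ E} (CB : NonUnitalStarSubalgebra ℂ E) (φ : A →ₙₐ[ℂ] B) : Prop :=
  ∀ a : A, (a : D) ∈ normalisers A CA → (φ a : E) ∈ normalisers B CB

end OperatorAlgebras

/-- A finite digraph that is reflexive and transitive. -/
structure FiniteDigraph where
  size : ℕ
  edge : Fin size → Fin size → Prop
  refl : ∀ i, edge i i
  trans : ∀ i j k, edge i j → edge j k → edge i k

namespace FiniteDigraph

/-- The full matrix algebra `M_n` in which the digraph algebra lives. -/
def Mat (G : FiniteDigraph) : Type := Matrix (Fin G.size) (Fin G.size) ℂ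

/-- `M_n` as a C*-algebra: matrix operations, conjugate transpose, `ℓ²` operator norm. -/
noncomputable instance (G : FiniteDigraph) : CStarAlgebra G.Mat :=
  Matrix.instCStarAlgebra (n := Fin G.size)

/-- The `(i, j)` entry of a matrix. -/
def entry {G : FiniteDigraph} (a : G.Mat) (i j : Fin G.size) : ℂ :=
  (a : Matrix (Fin G.size) (Fin G.size) ℂ) i j

lemma entry_zero {G : FiniteDigraph} (i j : Fin G.size) : entry (0 : G.Mat) i j = 0 := by
  rfl

lemma entry_add {G : FiniteDigraph} (a b : G.Mat) (i j : Fin G.size) :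
    entry (a + b) i j = entry a i j + entry b i j := rfl

lemma entry_smul {G : FiniteDigraph} (c : ℂ) (a : G.Mat) (i j : Fin G.size) :
    entry (c • a) i j = c * entry a i j := rfl

lemma entry_mul {G : FiniteDigraph} (a b : G.Mat) (i k : Fin G.size) :
    entry (a * b) i k = ∑ j, entry a i j * entry b j k := rfl

lemma entry_star {G : FiniteDigraph} (a : G.Mat) (i j : Fin G.size) :
    entry (star a) i j = star (entry a j i) := rfl

/-- The digraph algebra of `G`: the span of the matrix units `e_{i,j}` with `(i, j)` an edge,
that is, the matrices supported on the edges of `G`. -/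
def algebra (G : FiniteDigraph) : NonUnitalSubalgebra ℂ G.Mat where
  carrier := {a | ∀ i j, ¬ G.edge i j → entry a i j = 0}
  zero_mem' := fun _ _ _ => rfl
  add_mem' := by
    intro a b ha hb i j h
    rw [entry_add, ha i j h, hb i j h, add_zero]
  smul_mem' := by
    intro c a ha i j h
    rw [entry_smul, ha i j h, mul_zero]
  mul_mem' := by
    intro a b ha hb i k h
    rw [entry_mul]
    refine Finset.sum_eq_zero fun j _ => ?_
    by_cases hij : G.edge i j
    · rw [hb j k fun hjk => h (G.trans i j k hij hjk), mul_zero]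
    · rw [ha i j hij, zero_mul]

/-- The masa of the digraph algebra: the diagonal matrices. -/
def masa (G : FiniteDigraph) : NonUnitalStarSubalgebra ℂ G.Mat where
  carrier := {a | ∀ i j, i ≠ j → entry a i j = 0}
  zero_mem' := fun _ _ _ => rfl
  add_mem' := by
    intro a b ha hb i j h
    rw [entry_add, ha i j h, hb i j h, add_zero]
  smul_mem' := by
    intro c a ha i j h
    rw [entry_smul, ha i j h, mul_zero]
  mul_mem' := by
    intro a b ha hb i k h
    rw [entry_mul]
    refine Finset.sum_eq_zero fun j _ => ?_
    by_cases hij : i = j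
    · rw [hb j k fun hjk => h (hij.trans hjk), mul_zero]
    · rw [ha i j hij, zero_mul]
  star_mem' := by
    intro a ha i j h
    rw [entry_star, ha j i h.symm, star_zero]

end FiniteDigraph

/-- `(A, C)` is a regular limit of digraph algebras: there is a sequence of digraph algebras with
masas `(A_k, C_k)` and regular star extendible injections `φ_k : A_k → A_{k+1}` such that `A` is
the limit of the system, with `C` the limit of the `C_k`. The limit is given by compatible star
extendible injections `ψ_k : A_k → A` for which the union of the `ψ_k(A_k)` is dense in `A` and
`C` is the closure of the union of the `ψ_k(C_k)`. -/
def IsRegularLimitOfDigraphAlgebras {D : Type u} [NonUnitalCStarAlgebra D]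
    (A : NonUnitalSubalgebra ℂ D) (C : NonUnitalStarSubalgebra ℂ D) : Prop :=
  ∃ (G : ℕ → FiniteDigraph)
    (φ : ∀ k, (G k).algebra →ₙₐ[ℂ] (G (k + 1)).algebra)
    (ψ : ∀ k, (G k).algebra →ₙₐ[ℂ] A),
    (∀ k, Function.Injective (φ k) ∧ IsStarExtendible (φ k) ∧
      IsRegularMap (G k).masa (G (k + 1)).masa (φ k)) ∧
    (∀ k, Function.Injective (ψ k) ∧ IsStarExtendible (ψ k)) ∧
    (∀ k a, ψ (k + 1) (φ k a) = ψ k a) ∧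
    (A : Set D) = closure (⋃ k, {x : D | ∃ a : (G k).algebra, (ψ k a : D) = x}) ∧
    (C : Set D) = closure
      (⋃ k, {x : D | ∃ a : (G k).algebra, (a : (G k).Mat) ∈ (G k).masa ∧ (ψ k a : D) = x})

/-! ### Rigidity of partial isometries normalising an abelian algebra -/

section NormalisingPartialIsometries

variable {D : Type u} [NonUnitalCStarAlgebra D]

/-! The substantial direction turns local approximation into a nested system. Separability gives
regular embeddings `φ k` of digraph algebras whose ranges approximate every element of `A`, but
these ranges need not increase. What has to be shown is that a given regular embedding `φ₁` factors
through a small perturbation of some `φ k` (`exists_extension`).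

The mechanism is rigidity. Let `f` be the matrix units coming from `φ₁` and `e` those coming from `φ
k`. A product `e m m * f i j * e l l` is again a partial isometry normalising `C`, so it is zero or
has norm one. If it is also close to a multiple of `e m l`, it is zero or a full partial isometry
from `e l l` to `e m m`. Hence `f i j` carries each `e l l` that it does not kill exactly onto some
`e m m`, and differs from `e m l` there only by unitaries of corners. These unitaries normalise `C`
and are near scalars, so they commute with the projections of `C`; since diagonals of the `φ k`
exhaust `C`, maximality puts them in `C`. Chosen coherently, they add up to one `u ∈ C` with `f i j
* e l l = u * e m l * star u` (`exists_intertwining_unitary`).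

Conjugating `φ k` by `u` gives an embedding whose range contains that of `φ₁`: the pairs `(m, l)`
needed for edges of `φ₁` are themselves edges, because an edge unit of `φ₁` is also close to the
range of `φ k`. Since `u` is close to a diagonal element of that range, conjugation does not spoil
the approximation. Iterating over a dense sequence gives the limit; the diagonals are dense in `C`
by pinching.

In the other direction the maps into the limit approximate by definition, and only their regularity
needs proof (`isRegularMap_of_limit`): normalisers and diagonals can be pushed to a common later
stage, and `C` is the closure of the diagonals. -/

lemma IsStarProjection.norm_eq_one {q : D} (hq : IsStarProjection q) (h0 : q ≠ 0) : ‖q‖ = 1 := by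
  have h : ‖q‖ * ‖q‖ = ‖q‖ := by
    rw [← CStarRing.norm_star_mul_self, hq.isSelfAdjoint.star_eq, hq.isIdempotentElem.eq]
  exact mul_left_cancel₀ (norm_ne_zero_iff.2 h0) (by rw [h, mul_one])

lemma norm_le_one_of_isStarProjection {x : D} (h : IsStarProjection (star x * x)) : ‖x‖ ≤ 1 := by
  have h1 := IsStarProjection.norm_le _ h
  rw [CStarRing.norm_star_mul_self] at h1
  nlinarith [norm_nonneg x]

lemma norm_eq_one_of_isStarProjection {x : D} (h : IsStarProjection (star x * x))
    (h0 : star x * x ≠ 0) : ‖x‖ = 1 := by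
  have h1 := h.norm_eq_one h0
  rw [CStarRing.norm_star_mul_self] at h1
  nlinarith [norm_nonneg x]

lemma norm_mul_isStarProjection_le (x : D) {q : D} (hq : IsStarProjection q) :
    ‖x * q‖ ≤ ‖x‖ :=
  (norm_mul_le _ _).trans (mul_le_of_le_one_right (norm_nonneg _) (IsStarProjection.norm_le _ hq))

lemma norm_isStarProjection_mul_le (x : D) {q : D} (hq : IsStarProjection q) :
    ‖q * x‖ ≤ ‖x‖ :=
  (norm_mul_le _ _).trans (mul_le_of_le_one_left (norm_nonneg _) (IsStarProjection.norm_le _ hq))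

/-- A sum of elements with pairwise orthogonal initial and final supports. -/
lemma norm_sum_le_of_orthogonal {ι : Type*} [Fintype ι] {x : ι → D} {K : ℝ} (hK : 0 ≤ K)
    (hl : ∀ i j, i ≠ j → star (x i) * x j = 0) (hr : ∀ i j, i ≠ j → x i * star (x j) = 0)
    (hx : ∀ i, ‖x i‖ ≤ K) : ‖∑ i, x i‖ ≤ K := by
  classical
  have h1 : star (∑ i, x i) * ∑ i, x i = ∑ i, star (x i) * x i := by
    rw [star_sum, Finset.sum_mul_sum]
    refine Finset.sum_congr rfl fun i _ => ?_
    rw [Finset.sum_eq_single i (fun j _ hj => hl i j hj.symm) (by simp)]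
  have h2 : ‖∑ i, star (x i) * x i‖₊ ≤ (⟨K, hK⟩ : NNReal) ^ 2 := by
    rw [IsSelfAdjoint.nnnorm_sum_eq_sup Finset.univ (fun i _ => IsSelfAdjoint.star_mul_self (x i))]
    · refine Finset.sup_le fun i _ => ?_
      rw [CStarRing.nnnorm_star_mul_self, ← sq]
      exact pow_le_pow_left' (show ‖x i‖₊ ≤ _ from hx i) 2
    · intro i j hij
      change star (x i) * x i * (star (x j) * x j) = 0
      rw [mul_assoc, ← mul_assoc (x i), hr i j hij, zero_mul, mul_zero]
  have h3 : ‖∑ i, x i‖ * ‖∑ i, x i‖ ≤ K ^ 2 := by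
    rw [← CStarRing.norm_star_mul_self, h1]
    exact h2
  nlinarith [norm_nonneg (∑ i, x i)]

/-- A partial isometry whose support projections lie in `C` and which conjugates `C` into itself. -/
structure IsNormalising (C : NonUnitalStarSubalgebra ℂ D) (w : D) : Prop where
  mul_star_mul : w * star w * w = w
  mul_star_mem : w * star w ∈ C
  star_mul_mem : star w * w ∈ C
  conj_mem : ∀ c ∈ C, w * c * star w ∈ C
  star_conj_mem : ∀ c ∈ C, star w * c * w ∈ C

namespace IsNormalising

variable {C : NonUnitalStarSubalgebra ℂ D} {v w q : D}

lemma star (hw : IsNormalising C w) : IsNormalising C (star w) where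
  mul_star_mul := by
    have := congrArg Star.star hw.mul_star_mul
    simpa [mul_assoc] using this
  mul_star_mem := by simpa using hw.star_mul_mem
  star_mul_mem := by simpa using hw.mul_star_mem
  conj_mem c hc := by simpa using hw.star_conj_mem c hc
  star_conj_mem c hc := by simpa using hw.conj_mem c hc

lemma mul (hC : ∀ x ∈ C, ∀ y ∈ C, x * y = y * x) (hv : IsNormalising C v)
    (hw : IsNormalising C w) : IsNormalising C (v * w) where
  mul_star_mul := by
    have h := hC _ hv.star_mul_mem _ hw.mul_star_mem
    calc v * w * Star.star (v * w) * (v * w)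
        = v * ((w * Star.star w) * (Star.star v * v)) * w := by simp only [star_mul, mul_assoc]
      _ = (v * Star.star v * v) * (w * Star.star w * w) := by rw [← h]; simp only [mul_assoc]
      _ = v * w := by rw [hv.mul_star_mul, hw.mul_star_mul]
  mul_star_mem := by
    have := hv.conj_mem _ hw.mul_star_mem
    simpa [mul_assoc] using this
  star_mul_mem := by
    have := hw.star_conj_mem _ hv.star_mul_mem
    simpa [mul_assoc] using this
  conj_mem c hc := by
    have := hv.conj_mem _ (hw.conj_mem c hc)
    simpa [mul_assoc] using this
  star_conj_mem c hc := by
    have := hw.star_conj_mem _ (hv.star_conj_mem c hc)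
    simpa [mul_assoc] using this

lemma of_isStarProjection (hq : IsStarProjection q) (h : q ∈ C) : IsNormalising C q where
  mul_star_mul := by
    rw [hq.isSelfAdjoint.star_eq, hq.isIdempotentElem.eq, hq.isIdempotentElem.eq]
  mul_star_mem := mul_mem h (star_mem h)
  star_mul_mem := mul_mem (star_mem h) h
  conj_mem _ hc := mul_mem (mul_mem h hc) (star_mem h)
  star_conj_mem _ hc := mul_mem (mul_mem (star_mem h) hc) h

lemma isStarProjection_star_mul (hw : IsNormalising C w) :
    IsStarProjection (Star.star w * w) where
  isIdempotentElem := by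
    rw [IsIdempotentElem, mul_assoc, ← mul_assoc w, hw.mul_star_mul]
  isSelfAdjoint := IsSelfAdjoint.star_mul_self w

lemma isStarProjection_mul_star (hw : IsNormalising C w) :
    IsStarProjection (w * Star.star w) := by
  simpa using hw.star.isStarProjection_star_mul

lemma norm_le_one (hw : IsNormalising C w) : ‖w‖ ≤ 1 :=
  norm_le_one_of_isStarProjection hw.isStarProjection_star_mul

lemma norm_eq_one (hw : IsNormalising C w) (h0 : w ≠ 0) : ‖w‖ = 1 :=
  norm_eq_one_of_isStarProjection hw.isStarProjection_star_mul
    fun h => h0 (CStarRing.star_mul_self_eq_zero_iff w |>.1 h)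

/-- A normalising partial isometry which is close to a multiple of another one and is subordinate
to its initial projection has the same initial projection. -/
lemma star_mul_eq (hC : ∀ x ∈ C, ∀ y ∈ C, x * y = y * x) {x e p : D} (hx : IsNormalising C x)
    (he : IsNormalising C e) (hp : Star.star e * e = p) (hxp : x * p = x) {μ : ℂ} {η : ℝ}
    (hη : η ≤ 1 / 2) (hμ : ‖x - μ • e‖ < η) (h0 : x ≠ 0) : Star.star x * x = p := by
  have hpp : IsStarProjection p := hp ▸ he.isStarProjection_star_mul
  have hpC : p ∈ C := hp ▸ he.star_mul_mem
  -- The defect `t` is killed by `x` but, if nonzero, not shrunk by `e`. This forces `‖μ‖ < η`, so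
  -- `‖x‖ < 2 * η ≤ 1`, while a nonzero partial isometry has norm one.
  have ht : IsStarProjection (p - Star.star x * x) :=
    hx.isStarProjection_star_mul.sub_of_mul_eq_left hpp (by rw [mul_assoc, hxp])
  by_contra hne
  have ht0 : p - Star.star x * x ≠ 0 := fun h => hne (sub_eq_zero.1 h).symm
  set t := p - Star.star x * x with ht_def
  have hxt : x * t = 0 := by rw [ht_def, mul_sub, hxp, ← mul_assoc, hx.mul_star_mul, sub_self]
  have hpt : p * t = t := by
    rw [ht_def, mul_sub, hpp.isIdempotentElem.eq, ← hC _ hx.star_mul_mem _ hpC, mul_assoc, hxp]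
  have het : ‖e * t‖ = 1 := by
    have h1 : Star.star (e * t) * (e * t) = t := by
      rw [star_mul, mul_assoc, ← mul_assoc (Star.star e), hp, hpt, ht.isSelfAdjoint.star_eq,
        ht.isIdempotentElem.eq]
    exact norm_eq_one_of_isStarProjection (by rwa [h1]) (by rwa [h1])
  have h2 : ‖μ‖ < η := by
    have h3 : (x - μ • e) * t = -(μ • (e * t)) := by
      rw [sub_mul, hxt, zero_sub, smul_mul_assoc]
    have h4 := norm_mul_isStarProjection_le (x - μ • e) ht
    rw [h3, norm_neg, norm_smul, het, mul_one] at h4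
    exact h4.trans_lt hμ
  have h5 : ‖x‖ ≤ ‖x - μ • e‖ + ‖μ‖ * ‖e‖ := by
    rw [← norm_smul]
    simpa using norm_add_le (x - μ • e) (μ • e)
  rw [hx.norm_eq_one h0] at h5
  nlinarith [he.norm_le_one, norm_nonneg μ, norm_nonneg e]

lemma mul_star_eq (hC : ∀ x ∈ C, ∀ y ∈ C, x * y = y * x) {x e p : D} (hx : IsNormalising C x)
    (he : IsNormalising C e) (hp : e * Star.star e = p) (hxp : p * x = x) {μ : ℂ} {η : ℝ}
    (hη : η ≤ 1 / 2) (hμ : ‖x - μ • e‖ < η) (h0 : x ≠ 0) : x * Star.star x = p := by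
  have hpp : IsStarProjection p := hp ▸ he.isStarProjection_mul_star
  have h := star_mul_eq hC hx.star he.star (p := p) (by simpa using hp)
    (by rw [← hpp.isSelfAdjoint.star_eq, ← star_mul, hxp]) (μ := Star.star μ) hη
    (by rwa [← star_smul, ← star_sub, norm_star]) (by simpa using h0)
  simpa using h

/-- A normalising partial isometry close to an element with right support `p` is supported
on `p`. -/
lemma mul_eq_self_of_near (hC : ∀ x ∈ C, ∀ y ∈ C, x * y = y * x) {f b p : D}
    (hf : IsNormalising C f) (hp : IsStarProjection p) (hpC : p ∈ C) (hb : b * p = b)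
    (hfb : ‖f - b‖ < 1) : f * p = f := by
  have hcom := hC _ hf.star_mul_mem _ hpC
  -- Here `t` is the part of the initial projection outside `p`. Since `b` kills it, the partial
  -- isometry `f * t` has norm below one and so vanishes.
  have ht : IsStarProjection (Star.star f * f - Star.star f * f * p) :=
    (hf.isStarProjection_star_mul.mul hp hcom).sub_of_mul_eq_right hf.isStarProjection_star_mul
      (by rw [← mul_assoc, hf.isStarProjection_star_mul.isIdempotentElem.eq])
  set t := Star.star f * f - Star.star f * f * p with ht_def
  have hpt : p * t = 0 := by
    rw [ht_def, mul_sub, hcom, ← mul_assoc p p, hp.isIdempotentElem.eq, sub_self]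
  have hft : Star.star f * f * t = t := by
    rw [ht_def, mul_sub, ← mul_assoc _ _ p, hf.isStarProjection_star_mul.isIdempotentElem.eq]
  have hbt : b * t = 0 := by rw [← hb, mul_assoc, hpt, mul_zero]
  have hn : ‖f * t‖ < 1 := by
    have := norm_mul_isStarProjection_le (f - b) ht
    rw [sub_mul, hbt, sub_zero] at this
    exact this.trans_lt hfb
  have h1 : Star.star (f * t) * (f * t) = t := by
    rw [star_mul, mul_assoc, ← mul_assoc (Star.star f), hft, ht.isSelfAdjoint.star_eq,
      ht.isIdempotentElem.eq]
  have ht0 : t = 0 := by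
    by_contra h
    exact hn.ne (norm_eq_one_of_isStarProjection (by rwa [h1]) (by rwa [h1]))
  have h2 : f * t = f - f * p := by
    rw [ht_def, mul_sub, ← mul_assoc, ← mul_assoc, ← mul_assoc, hf.mul_star_mul]
  rw [ht0, mul_zero] at h2
  exact (sub_eq_zero.1 h2.symm).symm

lemma mul_eq_self_of_near' (hC : ∀ x ∈ C, ∀ y ∈ C, x * y = y * x) {f b p : D}
    (hf : IsNormalising C f) (hp : IsStarProjection p) (hpC : p ∈ C) (hb : p * b = b)
    (hfb : ‖f - b‖ < 1) : p * f = f := by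
  have h := mul_eq_self_of_near hC hf.star hp hpC (b := Star.star b)
    (by rw [← hp.isSelfAdjoint.star_eq, ← star_mul, hb]) (by rwa [← star_sub, norm_star])
  have := congrArg Star.star h
  simpa [hp.isSelfAdjoint.star_eq] using this

/-- If `t` is the part of `q` outside `d * q * star d`, then `t * d * t = 0`. Compressing `d - μ •
p` by `t` leaves `-μ • t`, whose norm is below `η`; but `‖d‖ = 1` makes `‖μ‖ > η`, so `t = 0`. -/
lemma le_conj_of_near_smul (hC : ∀ x ∈ C, ∀ y ∈ C, x * y = y * x) {d p : D}
    (hd : IsNormalising C d) (hl : Star.star d * d = p) (h0 : d ≠ 0)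
    {μ : ℂ} {η : ℝ} (hη : η ≤ 1 / 2) (hμ : ‖d - μ • p‖ < η) {q : D}
    (hq : IsStarProjection q) (hqC : q ∈ C) (hqp : p * q = q) :
    q * (d * q * Star.star d) = q := by
  have hp : IsStarProjection p := hl ▸ hd.isStarProjection_star_mul
  have hdp : d * p = d := by rw [← hl, ← mul_assoc, hd.mul_star_mul]
  have hμ' : η < ‖μ‖ := by
    have h5 : ‖d‖ ≤ ‖d - μ • p‖ + ‖μ‖ * ‖p‖ := by
      rw [← norm_smul]
      simpa using norm_add_le (d - μ • p) (μ • p)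
    rw [hd.norm_eq_one h0] at h5
    nlinarith [IsStarProjection.norm_le _ hp, norm_nonneg μ, norm_nonneg p]
  set q' := d * q * Star.star d with hq'_def
  have hq'C : q' ∈ C := hd.conj_mem q hqC
  have hdq : q' * d = d * q := by
    rw [hq'_def, mul_assoc, hl, mul_assoc, ← hC _ (hl ▸ hd.star_mul_mem) _ hqC, hqp]
  have hqs := hq.isSelfAdjoint.star_eq
  have hqi := hq.isIdempotentElem.eq
  have hq' : IsStarProjection q' := by
    constructor
    · rw [IsIdempotentElem]
      nth_rw 2 [hq'_def]
      rw [← mul_assoc, ← mul_assoc, hdq, mul_assoc d, hqi]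
    · rw [IsSelfAdjoint, hq'_def, star_mul, star_mul, star_star, hqs, mul_assoc]
  have hcom := hC _ hqC _ hq'C
  have ht : IsStarProjection (q - q * q') :=
    (hq.mul hq' hcom).sub_of_mul_eq_right hq (by rw [← mul_assoc, hqi])
  set t := q - q * q' with ht_def
  have hqt : q * t = t := by rw [ht_def, mul_sub, ← mul_assoc, hqi]
  have htq' : t * q' = 0 := by
    rw [ht_def, sub_mul, mul_assoc, hq'.isIdempotentElem.eq, sub_self]
  have hpt : p * t = t := by rw [← hqt, ← mul_assoc, hqp]
  have h1 : t * (d * t) = 0 := by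
    rw [← hqt, ← mul_assoc d, ← hdq, ← mul_assoc, ← mul_assoc]
    rw [hqt, htq', zero_mul, zero_mul]
  have h2 : t * ((d - μ • p) * t) = -(μ • t) := by
    rw [sub_mul d, mul_sub t, h1, smul_mul_assoc, hpt, mul_smul_comm, ht.isIdempotentElem.eq, zero_sub]
  have h3 : ‖μ‖ * ‖t‖ < η := by
    rw [← norm_smul, ← norm_neg, ← h2]
    exact ((norm_isStarProjection_mul_le _ ht).trans (norm_mul_isStarProjection_le _ ht)).trans_lt
      hμ
  have ht0 : t = 0 := by
    by_contra h
    rw [ht.norm_eq_one h] at h3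
    linarith
  exact (sub_eq_zero.1 (ht_def ▸ ht0)).symm

/-- A normalising partial unitary which is close to a scalar commutes with the projections
of `C`. -/
lemma commute_of_near_smul (hC : ∀ x ∈ C, ∀ y ∈ C, x * y = y * x) {d p : D}
    (hd : IsNormalising C d) (hl : Star.star d * d = p) (hr : d * Star.star d = p)
    {μ : ℂ} {η : ℝ} (hη : η ≤ 1 / 2) (hμ : ‖d - μ • p‖ < η) {q : D}
    (hq : IsStarProjection q) (hqC : q ∈ C) : d * q = q * d := by
  by_cases h0 : d = 0
  · simp [h0]
  have hp : IsStarProjection p := hl ▸ hd.isStarProjection_star_mul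
  have hpC : p ∈ C := hl ▸ hd.star_mul_mem
  have hdp : d * p = d := by rw [← hl, ← mul_assoc, hd.mul_star_mul]
  have hpd : p * d = d := by rw [← hr, hd.mul_star_mul]
  -- Applied to `d` and to its adjoint, the previous lemma puts `q` below both of its conjugates;
  -- together these say that `d` commutes with `q`.
  have key : ∀ q : D, IsStarProjection q → q ∈ C → p * q = q → d * q = q * d := by
    intro q hq hqC hqp
    have h1 := le_conj_of_near_smul hC hd hl h0 hη hμ hq hqC hqp
    have h2 := le_conj_of_near_smul hC hd.star (p := p) (by simpa using hr) (by simpa using h0)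
      (μ := Star.star μ) hη
      (by rwa [← hp.isSelfAdjoint.star_eq, ← star_smul, ← star_sub, norm_star]) hq hqC hqp
    rw [star_star] at h2
    have hqp' : q * p = q := by rw [hC _ hqC _ hpC, hqp]
    have h3 : d * q = d * q * Star.star d * q * d := by
      nth_rw 1 [← h2]
      simp only [mul_assoc]
    have h4 : d * q = q * (d * q * Star.star d) * d := by
      rw [hC _ hqC _ (hd.conj_mem q hqC)]; exact h3
    rw [h1] at h4
    exact h4
  have h1 := key (p * q) (hp.mul hq (hC _ hpC _ hqC)) (mul_mem hpC hqC)
    (by rw [← mul_assoc, hp.isIdempotentElem.eq])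
  calc d * q = d * (p * q) := by rw [← mul_assoc, hdp]
    _ = q * (p * d) := by rw [h1, hC _ hpC _ hqC, mul_assoc]
    _ = q * d := by rw [hpd]

end IsNormalising

end NormalisingPartialIsometries

/-! ### Normalising matrix units and their compressions -/

section NormalisingSystems

variable {D : Type u} [NonUnitalCStarAlgebra D]

/-- A system of matrix units over an equivalence relation `r`, lying in the star algebra generated
by `A` and normalising `C`. -/
structure IsNormalisingSystem (A : NonUnitalSubalgebra ℂ D) (C : NonUnitalStarSubalgebra ℂ D)
    {ι : Type*} (r : Setoid ι) (e : ι → ι → D) : Prop where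
  star_eq : ∀ i j, star (e i j) = e j i
  eq_zero : ∀ i j, ¬ r i j → e i j = 0
  mul_eq : ∀ i j k, r i j → r j k → e i j * e j k = e i k
  orthogonal : ∀ i j, i ≠ j → e i i * e j j = 0
  diag_ne_zero : ∀ i, e i i ≠ 0
  diag_mem : ∀ i, e i i ∈ C
  conj_mem : ∀ i j, ∀ c ∈ C, e i j * c * e j i ∈ C
  mem_adjoin : ∀ i j, e i j ∈ NonUnitalStarAlgebra.adjoin ℂ (A : Set D)

namespace IsNormalisingSystem

variable {A : NonUnitalSubalgebra ℂ D} {C : NonUnitalStarSubalgebra ℂ D}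
  {ι : Type*} {r : Setoid ι} {e : ι → ι → D}

lemma isStarProjection (he : IsNormalisingSystem A C r e) (i : ι) :
    IsStarProjection (e i i) :=
  ⟨he.mul_eq i i i (r.refl i) (r.refl i), he.star_eq i i⟩

lemma diag_mul_self (he : IsNormalisingSystem A C r e) (i : ι) : e i i * e i i = e i i :=
  (he.isStarProjection i).isIdempotentElem

lemma diag_mul (he : IsNormalisingSystem A C r e) (i j : ι) : e i i * e i j = e i j := by
  by_cases h : r i j
  · exact he.mul_eq _ _ _ (r.refl i) h
  · rw [he.eq_zero i j h, mul_zero]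

lemma mul_diag (he : IsNormalisingSystem A C r e) (i j : ι) : e i j * e j j = e i j := by
  by_cases h : r i j
  · exact he.mul_eq _ _ _ h (r.refl j)
  · rw [he.eq_zero i j h, zero_mul]

lemma mul_eq_diag (he : IsNormalisingSystem A C r e) {i j : ι} (h : r i j) :
    e i j * e j i = e i i :=
  he.mul_eq _ _ _ h (r.symm h)

lemma isNormalising (he : IsNormalisingSystem A C r e) (i j : ι) :
    IsNormalising C (e i j) where
  mul_star_mul := by
    by_cases h : r i j
    · rw [he.star_eq, he.mul_eq_diag h, he.diag_mul]
    · simp [he.eq_zero i j h]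
  mul_star_mem := by
    by_cases h : r i j
    · rw [he.star_eq, he.mul_eq_diag h]; exact he.diag_mem i
    · simp [he.eq_zero i j h, zero_mem]
  star_mul_mem := by
    by_cases h : r i j
    · rw [he.star_eq, he.mul_eq_diag (r.symm h)]; exact he.diag_mem j
    · simp [he.eq_zero i j h, zero_mem]
  conj_mem c hc := by rw [he.star_eq]; exact he.conj_mem i j c hc
  star_conj_mem c hc := by rw [he.star_eq]; exact he.conj_mem j i c hc

variable [Fintype ι]

lemma sum_mul_diag (he : IsNormalisingSystem A C r e) (l : ι) :
    (∑ i, e i i) * e l l = e l l := by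
  classical
  rw [Finset.sum_mul, Finset.sum_eq_single l (fun j _ hj => he.orthogonal j l hj) (by simp),
    he.diag_mul]

lemma isStarProjection_sum (he : IsNormalisingSystem A C r e) :
    IsStarProjection (∑ i, e i i) := by
  constructor
  · rw [IsIdempotentElem]
    nth_rw 2 [← Finset.sum_congr rfl fun i _ => he.diag_mul_self i]
    rw [Finset.mul_sum]
    exact Finset.sum_congr rfl fun i _ => by rw [← mul_assoc, he.sum_mul_diag, he.diag_mul_self]
  · rw [IsSelfAdjoint, star_sum]
    exact Finset.sum_congr rfl fun i _ => he.star_eq i i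

/-- The elements whose compressions by the diagonal projections are multiples of the matrix
units. -/
structure IsSpanned (e : ι → ι → D) (b : D) : Prop where
  sum_mul : (∑ i, e i i) * b = b
  mul_sum : b * ∑ i, e i i = b
  compress : ∀ m l, ∃ μ : ℂ, e m m * b * e l l = μ • e m l

/-- The compression is a normalising partial isometry near a multiple of `e m l`, so rigidity
applies on both sides. If `m` and `l` were unrelated, that multiple would be zero, against norm one.
-/
lemma compression_of_near (he : IsNormalisingSystem A C r e)
    (hC : ∀ x ∈ C, ∀ y ∈ C, x * y = y * x) {f b : D} {η : ℝ} (hη : η ≤ 1 / 2)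
    (hf : IsNormalising C f) (hb : IsSpanned e b) (hfb : ‖f - b‖ < η) (m l : ι)
    (h0 : e m m * f * e l l ≠ 0) :
    star (e m m * f * e l l) * (e m m * f * e l l) = e l l ∧
    (e m m * f * e l l) * star (e m m * f * e l l) = e m m ∧ r m l ∧
    ∃ μ : ℂ, ‖e m m * f * e l l - μ • e m l‖ < η := by
  obtain ⟨μ, hμ⟩ := hb.compress m l
  have hx : IsNormalising C (e m m * f * e l l) :=
    ((he.isNormalising m m).mul hC hf).mul hC (he.isNormalising l l)
  have hn : ‖e m m * f * e l l - μ • e m l‖ < η := by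
    rw [← hμ, ← sub_mul, ← mul_sub]
    exact ((norm_mul_isStarProjection_le _ (he.isStarProjection l)).trans
      (norm_isStarProjection_mul_le _ (he.isStarProjection m))).trans_lt hfb
  have hr : r m l := by
    by_contra h
    rw [he.eq_zero m l h, smul_zero, sub_zero, hx.norm_eq_one h0] at hn
    linarith
  refine ⟨?_, ?_, hr, μ, hn⟩
  · refine IsNormalising.star_mul_eq hC hx (he.isNormalising m l) ?_ ?_ hη hn h0
    · rw [he.star_eq, he.mul_eq_diag (r.symm hr)]
    · rw [mul_assoc, he.diag_mul_self]
  · refine IsNormalising.mul_star_eq hC hx (he.isNormalising m l) ?_ ?_ hη hn h0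
    · rw [he.star_eq, he.mul_eq_diag hr]
    · rw [← mul_assoc, ← mul_assoc, he.diag_mul_self]

lemma diag_mul_of_near (he : IsNormalisingSystem A C r e)
    (hC : ∀ x ∈ C, ∀ y ∈ C, x * y = y * x) {q b : D} {η : ℝ} (hη : η ≤ 1 / 2)
    (hq : IsStarProjection q) (hqC : q ∈ C) (hb : IsSpanned e b) (hqb : ‖q - b‖ < η) (l : ι)
    (h0 : q * e l l ≠ 0) : q * e l l = e l l := by
  have hcom := hC _ hqC _ (he.diag_mem l)
  have h1 : e l l * q * e l l = q * e l l := by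
    rw [← hcom, mul_assoc, he.diag_mul_self]
  have h2 := (he.compression_of_near hC hη (.of_isStarProjection hq hqC) hb hqb l l
    (by rwa [h1])).1
  have hp := hq.mul (he.isStarProjection l) hcom
  rwa [h1, hp.isSelfAdjoint.star_eq, hp.isIdempotentElem.eq] at h2

/-- One nonzero compression `e m m * f * e l l` already has the whole of `e l l` as initial
projection. By Pythagoras nothing remains for the other rows. -/
lemma exists_target_of_near (he : IsNormalisingSystem A C r e)
    (hC : ∀ x ∈ C, ∀ y ∈ C, x * y = y * x) {f b : D} {η : ℝ} (hη : η ≤ 1 / 2)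
    (hf : IsNormalising C f) (hb : IsSpanned e b) (hfb : ‖f - b‖ < η) (l : ι)
    (h0 : f * e l l ≠ 0) :
    ∃ m, e m m * f * e l l = f * e l l ∧ star (f * e l l) * (f * e l l) = e l l ∧
      (f * e l l) * star (f * e l l) = e m m ∧ r m l ∧ ∃ μ : ℂ, ‖f * e l l - μ • e m l‖ < η := by
  have hC_sum : ∑ i, e i i ∈ C := sum_mem fun i _ => he.diag_mem i
  have hpf : (∑ i, e i i) * f = f :=
    IsNormalising.mul_eq_self_of_near' hC hf he.isStarProjection_sum hC_sum hb.sum_mul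
      (hfb.trans_le (by linarith))
  have hsum : f * e l l = ∑ m, e m m * f * e l l := by
    rw [← Finset.sum_mul, ← Finset.sum_mul, hpf]
  obtain ⟨m, hm⟩ : ∃ m, e m m * f * e l l ≠ 0 := by
    by_contra! h
    exact h0 (hsum.trans (Finset.sum_eq_zero fun m _ => h m))
  obtain ⟨h1, h2, h3, h4⟩ := he.compression_of_near hC hη hf hb hfb m l hm
  have hmf : e m m * f * e l l = f * e l l := by
    have hcom := hC _ hf.star_mul_mem _ (he.diag_mem l)
    have hq : star f * f * e l l = e l l := by
      refine (he.isStarProjection l).isIdempotentElem ▸ ?_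
      have h5 : star f * f * (e l l * (star f * (e m m * f))) * e l l =
          e l l * (star f * (e m m * f)) * e l l := by
        rw [← mul_assoc _ (e l l), hcom]
        have : star f * f * star f = star f := by
          have := congrArg star hf.mul_star_mul
          simpa [mul_assoc] using this
        calc e l l * (star f * f) * (star f * (e m m * f)) * e l l
            = e l l * (star f * f * star f) * (e m m * f) * e l l := by simp only [mul_assoc]
          _ = _ := by rw [this]; simp only [mul_assoc]
      have h6 : e l l * (star f * (e m m * f)) * e l l = e l l := by
        refine Eq.trans ?_ h1
        simp only [star_mul, he.star_eq, mul_assoc]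
        rw [← mul_assoc (e m m) (e m m), he.diag_mul_self]
      rw [mul_assoc, h6] at h5
      rw [he.diag_mul_self]
      exact h5
    rw [← sub_eq_zero, ← CStarRing.star_mul_self_eq_zero_iff]
    have h7 : star (f * e l l) * (f * e l l) = e l l := by
      rw [star_mul, he.star_eq, mul_assoc, ← mul_assoc (star f), hq, he.diag_mul_self]
    have h8 : star (f * e l l) * (e m m * f * e l l) = e l l := by
      refine Eq.trans ?_ h1
      simp only [star_mul, he.star_eq, mul_assoc]
      rw [← mul_assoc (e m m) (e m m), he.diag_mul_self]
    have h9 : star (e m m * f * e l l) * (f * e l l) = e l l := by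
      have := congrArg star h8
      rwa [star_mul, star_star, he.star_eq] at this
    rw [star_sub, sub_mul, mul_sub, mul_sub, h1, h7, h8, h9]
    simp
  rw [hmf] at h1 h2 h4
  exact ⟨m, hmf, h1, h2, h3, h4⟩

end IsNormalisingSystem

end NormalisingSystems

/-! ### Intertwining two systems by a unitary in the masa -/

section Intertwining

variable {D : Type u} [NonUnitalCStarAlgebra D]

lemma adjoin_le_generatedCStar (A : NonUnitalSubalgebra ℂ D) :
    NonUnitalStarAlgebra.adjoin ℂ (A : Set D) ≤ generatedCStar A :=
  NonUnitalStarSubalgebra.le_topologicalClosure _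

namespace IsNormalisingSystem

variable {A : NonUnitalSubalgebra ℂ D} {C : NonUnitalStarSubalgebra ℂ D}
  {ι κ : Type*} [Fintype κ] {s : Setoid ι} {r : Setoid κ} {f : ι → ι → D} {e : κ → κ → D}

/-- The orthogonal projections `f i i` cannot both contain `e l l`, so at most one `f (ρ i) i` acts
nontrivially on `e l l`. Comparing it with `e m l` gives a normalising unitary of the corner at `l`,
near a scalar and therefore in `C`. -/
lemma exists_diagonal_unitary_component (hf : IsNormalisingSystem A C s f)
    (he : IsNormalisingSystem A C r e) (hC : ∀ x ∈ C, ∀ y ∈ C, x * y = y * x)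
    (hCproj : ∀ d ∈ generatedCStar A,
      (∀ q ∈ C, IsStarProjection q → d * q = q * d) → d ∈ C)
    {η : ℝ} (hη0 : 0 < η) (hη : η ≤ 1 / 2) {b : ι → ι → D} (hb : ∀ i j, IsSpanned e (b i j))
    (hfb : ∀ i j, ‖f i j - b i j‖ < η) (ρ : ι → ι) (l : κ) :
    ∃ d ∈ C, star d * d = e l l ∧ d * star d = e l l ∧ (∃ μ : ℂ, ‖d - μ • e l l‖ < η) ∧
      ∀ i, f (ρ i) i * e l l ≠ 0 → ∃ m, r m l ∧
        e m m * f (ρ i) i * e l l = f (ρ i) i * e l l ∧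
        f (ρ i) i * e l l * star (f (ρ i) i * e l l) = e m m ∧
        d = star (f (ρ i) i * e l l) * e m l := by
  have hfi : ∀ i, f (ρ i) i * e l l ≠ 0 → f i i * e l l = e l l := by
    intro i hi
    refine he.diag_mul_of_near hC hη (hf.isStarProjection i) (hf.diag_mem i) (hb i i) (hfb i i) l ?_
    intro h
    rw [← hf.mul_diag, mul_assoc, h, mul_zero] at hi
    exact hi rfl
  have huniq : ∀ i j, f (ρ i) i * e l l ≠ 0 → f (ρ j) j * e l l ≠ 0 → i = j := by
    intro i j hi hj
    by_contra hij
    have h := hfi i hi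
    rw [← hfi j hj, ← mul_assoc, hf.orthogonal i j hij, zero_mul] at h
    rw [hfi j hj] at h
    exact he.diag_ne_zero l h.symm
  by_cases hex : ∃ i, f (ρ i) i * e l l ≠ 0
  · obtain ⟨i, hi⟩ := hex
    obtain ⟨m, h1, h2, h3, h4, μ, h5⟩ := he.exists_target_of_near hC hη
      (hf.isNormalising (ρ i) i) (hb (ρ i) i) (hfb (ρ i) i) l hi
    set y := f (ρ i) i * e l l with hy
    have hyn : IsNormalising C y := (hf.isNormalising _ _).mul hC (he.isNormalising l l)
    have hmy : e m m * y = y := by rw [hy, ← mul_assoc]; exact h1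
    have hdn : IsNormalising C (star y * e m l) := hyn.star.mul hC (he.isNormalising m l)
    have hds : star (star y * e m l) = e l m * y := by rw [star_mul, star_star, he.star_eq]
    have hdl : star (star y * e m l) * (star y * e m l) = e l l := by
      rw [hds, mul_assoc, ← mul_assoc y, h3, he.diag_mul, he.mul_eq_diag (r.symm h4)]
    have hdr : (star y * e m l) * star (star y * e m l) = e l l := by
      rw [hds, mul_assoc, ← mul_assoc (e m l), he.mul_eq_diag h4, hmy, h2]
    have hnear : ‖star y * e m l - star μ • e l l‖ < η := by
      have h6 : star y * e m l - star μ • e l l = star (y - μ • e m l) * e m l := by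
        rw [star_sub, star_smul, sub_mul, smul_mul_assoc, he.star_eq, he.mul_eq_diag (r.symm h4)]
      rw [h6]
      refine (norm_mul_le _ _).trans_lt ?_
      rw [norm_star]
      exact (mul_le_of_le_one_right (norm_nonneg _) (he.isNormalising m l).norm_le_one).trans_lt h5
    refine ⟨star y * e m l, ?_, hdl, hdr, ⟨_, hnear⟩, ?_⟩
    · refine hCproj _ (mul_mem (star_mem (mul_mem ?_ ?_)) ?_) fun q hq hqp =>
        hdn.commute_of_near_smul hC hdl hdr hη hnear hqp hq
      · exact adjoin_le_generatedCStar A (hf.mem_adjoin _ _)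
      · exact adjoin_le_generatedCStar A (he.mem_adjoin _ _)
      · exact adjoin_le_generatedCStar A (he.mem_adjoin _ _)
    · intro j hj
      obtain rfl := huniq i j hi hj
      exact ⟨m, h4, h1, h3, rfl⟩
  -- No `f (ρ i) i` meets `e l l`, so there is nothing to correct and `d = e l l` serves.
  · have hstar := he.star_eq l l
    refine ⟨e l l, he.diag_mem l, by rw [hstar, he.diag_mul_self],
      by rw [hstar, he.diag_mul_self], ⟨1, by simpa using hη0⟩, fun i hi => (hex ⟨i, hi⟩).elim⟩

/-- Two approximately compatible systems are intertwined by a partial unitary in `C` which is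
close to the diagonal of the second system. -/
theorem exists_intertwining_unitary (hf : IsNormalisingSystem A C s f)
    (he : IsNormalisingSystem A C r e) (hC : ∀ x ∈ C, ∀ y ∈ C, x * y = y * x)
    (hCproj : ∀ d ∈ generatedCStar A,
      (∀ q ∈ C, IsStarProjection q → d * q = q * d) → d ∈ C)
    {η : ℝ} (hη0 : 0 < η) (hη : η ≤ 1 / 2) {b : ι → ι → D} (hb : ∀ i j, IsSpanned e (b i j))
    (hfb : ∀ i j, ‖f i j - b i j‖ < η) :
    ∃ u ∈ C, star u * u = ∑ l, e l l ∧ u * star u = ∑ l, e l l ∧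
      (∃ μ : κ → ℂ, ‖u - ∑ l, μ l • e l l‖ ≤ η) ∧
      ∀ i j, s i j → f i j * (∑ l, e l l) = f i j ∧
        ∀ l, f i j * e l l = 0 ∨ ∃ m, e m m * f i j * e l l ≠ 0 ∧
        f i j * e l l = u * e m l * star u := by
  classical
  -- All corrections within a class are measured against one base vertex; this is what makes them
  -- coherent.
  let ρ : ι → ι := fun i => Quotient.out (Quotient.mk s i)
  have hρ : ∀ i, s (ρ i) i := fun i => Quotient.mk_out (s := s) i
  have hρe : ∀ i j, s i j → ρ i = ρ j := fun i j h =>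
    congrArg Quotient.out (Quotient.sound (s := s) h)
  choose d hdC hdl hdr hdμ hd using
    hf.exists_diagonal_unitary_component he hC hCproj hη0 hη hb hfb ρ
  choose μ hμ using hdμ
  have hC_sum : ∑ i, e i i ∈ C := sum_mem fun i _ => he.diag_mem i
  have hdright : ∀ l, d l * e l l = d l := by
    intro l
    rw [← sub_eq_zero, ← CStarRing.star_mul_self_eq_zero_iff, star_sub, star_mul, he.star_eq]
    have h : star (d l) * (d l * e l l) = e l l := by rw [← mul_assoc, hdl, he.diag_mul_self]
    simp only [sub_mul, mul_sub, mul_assoc, hdl, h, he.diag_mul_self, sub_self]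
  have hdleft : ∀ l, e l l * d l = d l := fun l => by
    rw [hC _ (he.diag_mem l) _ (hdC l), hdright]
  have hdsl : ∀ l, e l l * star (d l) = star (d l) := fun l => by
    rw [← he.star_eq l l, ← star_mul, hdright]
  have hdsr : ∀ l, star (d l) * e l l = star (d l) := fun l => by
    rw [← he.star_eq l l, ← star_mul, hdleft]
  have hdd : ∀ k l, k ≠ l → star (d k) * d l = 0 := fun k l h => by
    rw [← hdsr, ← hdleft l, mul_assoc, ← mul_assoc (e k k), he.orthogonal k l h, zero_mul, mul_zero]
  have hdd' : ∀ k l, k ≠ l → d k * star (d l) = 0 := fun k l h => by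
    rw [← hdright, ← hdsl l, mul_assoc, ← mul_assoc (e k k), he.orthogonal k l h, zero_mul,
      mul_zero]
  have hul : ∀ l, (∑ k, d k) * e l l = d l := fun l => by
    rw [Finset.sum_mul, Finset.sum_eq_single l _ (by simp), hdright]
    intro k _ hk
    rw [← hdright, mul_assoc, he.orthogonal k l hk, mul_zero]
  have hus : ∀ l, e l l * star (∑ k, d k) = star (d l) := fun l => by
    rw [← he.star_eq l l, ← star_mul, hul]
  refine ⟨∑ l, d l, sum_mem fun l _ => hdC l, ?_, ?_, ⟨μ, ?_⟩, ?_⟩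
  · rw [star_sum, Finset.sum_mul_sum]
    refine Finset.sum_congr rfl fun k _ => ?_
    rw [Finset.sum_eq_single k (fun l _ h => hdd k l h.symm) (by simp), hdl]
  · rw [star_sum, Finset.sum_mul_sum]
    refine Finset.sum_congr rfl fun k _ => ?_
    rw [Finset.sum_eq_single k (fun l _ h => hdd' k l h.symm) (by simp), hdr]
  · rw [← Finset.sum_sub_distrib]
    have hleft : ∀ l, e l l * (d l - μ l • e l l) = d l - μ l • e l l := fun l => by
      rw [mul_sub, hdleft, mul_smul_comm, he.diag_mul_self]
    have hright : ∀ l, (d l - μ l • e l l) * e l l = d l - μ l • e l l := fun l => by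
      rw [sub_mul, hdright, smul_mul_assoc, he.diag_mul_self]
    refine norm_sum_le_of_orthogonal hη0.le ?_ ?_ fun l => (hμ l).le
    · intro k l h
      rw [← hleft k, ← hleft l, star_mul, he.star_eq, mul_assoc, ← mul_assoc (e k k),
        he.orthogonal k l h, zero_mul, mul_zero]
    · intro k l h
      rw [← hright k, ← hright l, star_mul, he.star_eq, mul_assoc, ← mul_assoc (e k k),
        he.orthogonal k l h, zero_mul, mul_zero]
  · intro i j hij
    refine ⟨IsNormalising.mul_eq_self_of_near hC (hf.isNormalising i j) he.isStarProjection_sum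
      hC_sum (hb i j).mul_sum ((hfb i j).trans_le (by linarith)), fun l => ?_⟩
    by_cases h0 : f i j * e l l = 0
    · exact Or.inl h0
    refine Or.inr ?_
    obtain ⟨k, hk1, hk2, hk3, hk4, -⟩ := he.exists_target_of_near hC hη
      (hf.isNormalising i j) (hb i j) (hfb i j) l h0
    refine ⟨k, by rwa [hk1], ?_⟩
    have hfl : f (ρ i) i * (e k k * f i j * e l l) = f (ρ j) j * e l l := by
      rw [hk1, ← mul_assoc, hf.mul_eq _ _ _ (hρ i) hij, hρe i j hij]
    have hjl : f (ρ j) j * e l l ≠ 0 := by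
      intro h
      apply h0
      have : f i (ρ i) * (f (ρ i) i * (e k k * f i j * e l l)) = f i j * e l l := by
        rw [← mul_assoc, hf.mul_eq_diag (s.symm (hρ i)), hk1, ← mul_assoc, hf.diag_mul]
      rw [← this, hfl, h, mul_zero]
    have hik : f (ρ i) i * e k k ≠ 0 := by
      intro h
      apply hjl
      rw [← hfl, ← mul_assoc, ← mul_assoc, h, zero_mul, zero_mul]
    obtain ⟨m, hm1, hm2, hm3, hm4⟩ := hd l j hjl
    obtain ⟨m', hm1', hm2', hm3', hm4'⟩ := hd k i hik
    -- `f (ρ i) i * f i j = f (ρ j) j`, so going to the base vertex from `k` or directly from `l`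
    -- ends at the same projection. In the product of the corrections the `e` factors then collapse
    -- to `e m' m'`.
    have hmm : m' = m := by
      by_contra hne
      apply hjl
      have h1 : e m' m' * (f (ρ j) j * e l l) = f (ρ j) j * e l l := by
        simp only [← hfl, ← mul_assoc, hm2']
      rw [← hm2, mul_assoc, ← h1, ← mul_assoc, he.orthogonal m m' (Ne.symm hne), zero_mul]
    subst hmm
    have hconj : (∑ k, d k) * e k l * star (∑ k, d k) = d k * e k l * star (d l) := by
      have h1 : e k k * e k l * e l l = e k l := by rw [he.diag_mul, he.mul_diag]
      rw [← hul k, ← hus l]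
      nth_rw 1 [← h1]
      simp only [mul_assoc]
    rw [hconj, hm4, hm4', star_mul (star (f (ρ j) j * e l l)), star_star, he.star_eq]
    have h1 : star (f (ρ i) i * e k k) * e m' k * e k l * (e l m' * (f (ρ j) j * e l l)) =
        star (f (ρ i) i * e k k) * (e m' m' * f (ρ j) j * e l l) := by
      have h2 : e m' k * (e k l * e l m') = e m' m' := by
        rw [he.mul_eq _ _ _ hk4 (r.symm hm1), he.mul_eq_diag hm1']
      rw [← h2]
      simp only [mul_assoc]
    rw [h1, hm2, ← hfl, hk1, star_mul, hf.star_eq, he.star_eq, mul_assoc,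
      ← mul_assoc (f i (ρ i)), hf.mul_eq_diag (s.symm (hρ i)), ← mul_assoc (f i i), hf.diag_mul,
      ← mul_assoc, hk1]

end IsNormalisingSystem

end Intertwining

/-! ### Consequences of maximality and pinching -/

section Masa

variable {D : Type u} [NonUnitalCStarAlgebra D]

/-- Adjoining a self-adjoint element of the commutant to `C` gives an abelian star algebra, so
maximality absorbs it. -/
lemma IsMasa.mem_of_isSelfAdjoint {M C : NonUnitalStarSubalgebra ℂ D} (hC : IsMasa M C) {x : D}
    (hx : x ∈ M) (hsa : IsSelfAdjoint x) (hcomm : ∀ c ∈ C, x * c = c * x) : x ∈ C := by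
  have hs : star x = x := hsa
  let S := NonUnitalStarAlgebra.adjoin ℂ ((C : Set D) ∪ {x})
  have hCS : C ≤ S := fun c hc => NonUnitalStarAlgebra.subset_adjoin ℂ _ (Or.inl hc)
  have hxS : x ∈ S := NonUnitalStarAlgebra.subset_adjoin ℂ _ (Or.inr rfl)
  have h1 : ∀ a ∈ (C : Set D) ∪ {x}, ∀ b ∈ (C : Set D) ∪ {x}, a * b = b * a := by
    rintro a (ha | rfl) b (hb | rfl)
    · exact hC.prop.2 a ha b hb
    · exact (hcomm a ha).symm
    · exact hcomm b hb
    · rfl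
  have h2 : ∀ b ∈ (C : Set D) ∪ {x}, star b ∈ (C : Set D) ∪ {x} := by
    rintro b (hb | rfl)
    · exact Or.inl (star_mem hb)
    · exact Or.inr hs
  have hS := NonUnitalStarAlgebra.isMulCommutative_adjoin ℂ h1 fun a ha b hb => h1 a ha _ (h2 b hb)
  refine hC.le_of_ge ⟨?_, fun a ha b hb => setLike_mul_comm ha hb⟩ hCS hxS
  refine NonUnitalStarAlgebra.adjoin_le ?_
  rintro b (hb | rfl)
  · exact hC.prop.1 hb
  · exact hx

lemma IsMasa.mem_of_commute {M C : NonUnitalStarSubalgebra ℂ D} (hC : IsMasa M C) {x : D}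
    (hx : x ∈ M) (hcomm : ∀ c ∈ C, x * c = c * x) : x ∈ C := by
  have hstar : ∀ c ∈ C, star x * c = c * star x := fun c hc => by
    have := congrArg star (hcomm (star c) (star_mem hc))
    simpa using this.symm
  have h1 : x + star x ∈ C := hC.mem_of_isSelfAdjoint (add_mem hx (star_mem hx))
    (IsSelfAdjoint.add_star_self x) fun c hc => by rw [add_mul, mul_add, hcomm c hc, hstar c hc]
  have h2 : Complex.I • (x - star x) ∈ C := by
    refine hC.mem_of_isSelfAdjoint (SMulMemClass.smul_mem _ (sub_mem hx (star_mem hx))) ?_ ?_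
    · rw [IsSelfAdjoint, star_smul, star_sub, star_star]
      simp only [RCLike.star_def, Complex.conj_I, neg_smul, smul_sub]
      abel
    · intro c hc
      rw [smul_mul_assoc, mul_smul_comm, sub_mul, mul_sub, hcomm c hc, hstar c hc]
  have h3 : x = (1 / 2 : ℂ) • (x + star x) + (-Complex.I / 2) • (Complex.I • (x - star x)) := by
    rw [smul_smul]
    have : -Complex.I / 2 * Complex.I = 1 / 2 := by
      rw [div_mul_eq_mul_div, neg_mul, Complex.I_mul_I, neg_neg]
    rw [this, ← smul_add]
    have h4 : x + star x + (x - star x) = (2 : ℂ) • x := by rw [two_smul]; abel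
    rw [h4, smul_smul]
    norm_num
  rw [h3]
  exact add_mem (SMulMemClass.smul_mem _ h1) (SMulMemClass.smul_mem _ h2)

/-- A projection which conjugates a commutative star algebra into itself commutes with it. -/
lemma IsStarProjection.commute_of_conj_mem {C : NonUnitalStarSubalgebra ℂ D}
    (hC : ∀ x ∈ C, ∀ y ∈ C, x * y = y * x) {p : D} (hp : IsStarProjection p)
    (h : ∀ c ∈ C, p * c * p ∈ C) {c : D} (hc : c ∈ C) : p * c = c * p := by
  have hpi := hp.isIdempotentElem.eq
  have hps := hp.isSelfAdjoint.star_eq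
  -- Since `p * c * p` lies in `C`, it commutes with `d`, so `d` maps its range into that of `p`.
  -- For `x = c * p - p * c * p` this yields `x * star x * x = 0`, hence `x = 0`.
  have key : ∀ d ∈ C, ∀ c ∈ C, d * p * c * p = p * d * p * c * p := by
    intro d hd c hc
    have h1 := hC _ hd _ (h c hc)
    have h2 : p * (d * (p * c * p)) = d * (p * c * p) := by
      rw [h1]
      simp only [← mul_assoc]
      rw [hpi]
    simpa [mul_assoc] using h2.symm
  have main : ∀ c ∈ C, star c = c → c * p = p * c * p := by
    intro c hc hcs
    set x := c * p - p * c * p with hx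
    have hxs : star x = p * c - p * c * p := by
      rw [hx, star_sub, star_mul, star_mul, star_mul, hcs, hps, mul_assoc]
    have hxp : x * p = x := by rw [hx, sub_mul, mul_assoc, mul_assoc (p * c), hpi]
    have hxx : star x * x = p * (c * c) * p - p * c * p * c * p := by
      rw [hxs, hx]
      simp only [mul_sub, sub_mul, mul_assoc]
      rw [← mul_assoc p p, hpi]
      abel
    have h1 : ∀ d ∈ C, x * (p * d * p) = 0 := by
      intro d hd
      rw [hx, sub_mul, sub_eq_zero]
      have := key c hc d hd
      simp only [mul_assoc] at this ⊢
      rw [← mul_assoc p p, hpi]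
      exact this
    have h2 : x * (star x * x) = 0 := by
      rw [hxx, mul_sub, h1 _ (mul_mem hc hc), zero_sub, neg_eq_zero]
      have : p * c * p * c * p = p * c * p * (p * c * p) := by
        simp only [mul_assoc]
        rw [← mul_assoc p p, hpi]
      rw [this, ← mul_assoc, h1 c hc, zero_mul]
    have h3 : x = 0 := by
      have h4 : star (star x * x) * (star x * x) = 0 := by
        rw [star_mul, star_star, mul_assoc, h2, mul_zero]
      exact (CStarRing.star_mul_self_eq_zero_iff x).1
        ((CStarRing.star_mul_self_eq_zero_iff _).1 h4)
    exact sub_eq_zero.1 h3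
  have main' : ∀ c ∈ C, star c = c → p * c = c * p := by
    intro c hc hcs
    have h1 := main c hc hcs
    have h2 := congrArg star h1
    simp only [star_mul, hps, hcs] at h2
    rw [h2, h1, mul_assoc, ← mul_assoc p p, hpi]
  have h1 := main' (c + star c) (add_mem hc (star_mem hc)) (IsSelfAdjoint.add_star_self c)
  have h2 := main' (Complex.I • (c - star c))
    (SMulMemClass.smul_mem _ (sub_mem hc (star_mem hc))) (by
      rw [star_smul, star_sub, star_star]
      simp only [RCLike.star_def, Complex.conj_I, neg_smul, smul_sub]
      abel)
  rw [mul_smul_comm, smul_mul_assoc] at h2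
  have h3 := smul_right_injective D Complex.I_ne_zero h2
  have h4 : (2 : ℂ) • (p * c) = (2 : ℂ) • (c * p) := by
    rw [mul_add, add_mul] at h1
    simp only [mul_sub, sub_mul] at h3
    rw [two_smul, two_smul]
    calc p * c + p * c = (p * c + p * star c) + (p * c - p * star c) := by abel
      _ = c * p + c * p := by rw [h1, h3]; abel
  exact smul_right_injective D (two_ne_zero) h4

variable {A : NonUnitalSubalgebra ℂ D} {C : NonUnitalStarSubalgebra ℂ D}

lemma IsOperatorAlgebraWithMasa.comm (h : IsOperatorAlgebraWithMasa A C) :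
    ∀ x ∈ C, ∀ y ∈ C, x * y = y * x :=
  h.isMasa.prop.2

lemma IsOperatorAlgebraWithMasa.mem_of_isStarProjection (h : IsOperatorAlgebraWithMasa A C)
    {p : D} (hp : IsStarProjection p) (hpn : p ∈ normalisers A C) : p ∈ C := by
  refine h.isMasa.mem_of_commute (subset_generatedCStar A hpn.1) fun c hc =>
    hp.commute_of_conj_mem h.comm (fun c hc => ?_) hc
  have := (hpn.2.2 c hc).1
  rwa [hp.isSelfAdjoint.star_eq] at this

lemma IsOperatorAlgebraWithMasa.isClosed_masa (h : IsOperatorAlgebraWithMasa A C) :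
    IsClosed (C : Set D) := by
  have hM : IsClosed (generatedCStar A : Set D) :=
    NonUnitalStarSubalgebra.isClosed_topologicalClosure _
  refine isClosed_of_closure_subset fun x hx => ?_
  refine h.isMasa.mem_of_commute (closure_minimal (fun c hc => h.isMasa.prop.1 hc) hM hx)
    fun c hc => ?_
  have : IsClosed {x : D | x * c = c * x} :=
    isClosed_eq (continuous_mul_const c) (continuous_const_mul c)
  exact closure_minimal (fun d hd => h.comm d hd c hc) this hx

/-- The pinching of an approximant of an element commuting with the diagonal. -/
lemma IsNormalisingSystem.norm_sub_pinching_le {ι : Type*} [Fintype ι] {r : Setoid ι}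
    {e : ι → ι → D} (he : IsNormalisingSystem A C r e) (hC : ∀ x ∈ C, ∀ y ∈ C, x * y = y * x)
    {c b : D} (hc : c ∈ C) (hb : (∑ i, e i i) * b = b) :
    ‖c - ∑ i, e i i * b * e i i‖ ≤ 2 * ‖c - b‖ := by
  set p := ∑ i, e i i with hp
  have hps := he.isStarProjection_sum
  have h1 : ‖∑ i, e i i * (c - b) * e i i‖ ≤ ‖c - b‖ := by
    have hle : ∀ i, star (e i i) = e i i := fun i => he.star_eq i i
    refine norm_sum_le_of_orthogonal (norm_nonneg _) ?_ ?_ fun i => ?_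
    · intro i j hij
      simp only [star_mul, hle, mul_assoc]
      rw [← mul_assoc (e i i) (e j j), he.orthogonal i j hij]
      simp
    · intro i j hij
      simp only [star_mul, hle, mul_assoc]
      rw [← mul_assoc (e i i) (e j j), he.orthogonal i j hij]
      simp
    · exact (norm_mul_isStarProjection_le _ (he.isStarProjection i)).trans
        (norm_isStarProjection_mul_le _ (he.isStarProjection i))
  have h2 : ∑ i, e i i * (c - b) * e i i = p * c - ∑ i, e i i * b * e i i := by
    rw [hp, Finset.sum_mul, ← Finset.sum_sub_distrib]
    refine Finset.sum_congr rfl fun i _ => ?_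
    rw [mul_sub, sub_mul, mul_assoc _ c, hC _ hc _ (he.diag_mem i), ← mul_assoc, he.diag_mul_self]
  -- The difference is `(1 - p) * (c - b)`, since `p * b = b`; the unitisation supplies the
  -- projection `1 - p`.
  have h3 : ‖c - p * c‖ ≤ ‖c - b‖ := by
    have h4 : c - p * c = (c - b) - p * (c - b) := by rw [mul_sub, hb]; abel
    have h7 : ‖((c - b : D) : Unitization ℂ D) - ((p * (c - b) : D) : Unitization ℂ D)‖ ≤
        ‖c - b‖ := by
      have h8 : ((c - b : D) : Unitization ℂ D) - ((p * (c - b) : D) : Unitization ℂ D) =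
          (1 - (p : Unitization ℂ D)) * ((c - b : D) : Unitization ℂ D) := by
        rw [sub_mul, one_mul, ← Unitization.inr_mul]
      have hP : IsStarProjection (1 - (p : Unitization ℂ D)) :=
        IsStarProjection.one_sub (hps.map (Unitization.inrNonUnitalStarAlgHom ℂ D))
      rw [h8]
      exact (norm_isStarProjection_mul_le _ hP).trans (Unitization.norm_inr (𝕜 := ℂ) _).le
    rw [h4]
    rwa [← Unitization.inr_sub, Unitization.norm_inr] at h7
  have h4 : c - ∑ i, e i i * b * e i i = (c - p * c) + ∑ i, e i i * (c - b) * e i i := by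
    rw [h2]; abel
  rw [h4]
  exact (norm_add_le _ _).trans (by linarith)

end Masa

/-! ### Matrix units of a digraph algebra -/

namespace FiniteDigraph

variable {G : FiniteDigraph}

lemma mat_ext {a b : G.Mat} (h : ∀ i j, entry a i j = entry b i j) : a = b :=
  Matrix.ext h

/-- The matrix units of `M_n`. -/
def unit (G : FiniteDigraph) (i j : Fin G.size) : G.Mat := Matrix.single i j (1 : ℂ)

lemma entry_unit (i j k l : Fin G.size) :
    entry (G.unit i j) k l = if i = k ∧ j = l then 1 else 0 := rfl

lemma unit_mul_unit (i j k : Fin G.size) : G.unit i j * G.unit j k = G.unit i k := by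
  refine (Matrix.single_mul_single_same (1 : ℂ) i j k 1).trans ?_
  rw [mul_one]; rfl

lemma unit_mul_unit_of_ne (i : Fin G.size) {j k : Fin G.size} (l : Fin G.size) (h : j ≠ k) :
    G.unit i j * G.unit k l = 0 :=
  Matrix.single_mul_single_of_ne (1 : ℂ) i j k h 1

lemma star_unit (i j : Fin G.size) : star (G.unit i j) = G.unit j i := by
  refine mat_ext fun k l => ?_
  rw [entry_star, entry_unit, entry_unit]
  simp only [and_comm]
  split_ifs <;> simp

lemma unit_mul_mul_unit (a : G.Mat) (i j k l : Fin G.size) :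
    G.unit i j * a * G.unit k l = entry a j k • G.unit i l := by
  refine (Matrix.single_mul_mul_single i j k l (1 : ℂ) a 1).trans ?_
  refine mat_ext fun x y => ?_
  rw [entry_smul, entry_unit]
  simp [entry, Matrix.single_apply]

lemma sum_unit : ∑ i, G.unit i i = 1 := by
  have := Matrix.sum_single_one (α := ℂ) (m := Fin G.size)
  exact this

lemma unit_ne_zero (i j : Fin G.size) : G.unit i j ≠ 0 := fun h => by
  have := congrArg (fun a => entry a i j) h
  simp [entry_unit, entry_zero] at this

lemma unit_mem_algebra {i j : Fin G.size} (h : G.edge i j) : G.unit i j ∈ G.algebra := by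
  intro k l hkl
  rw [entry_unit, if_neg]
  rintro ⟨rfl, rfl⟩
  exact hkl h

lemma unit_mem_masa (i : Fin G.size) : G.unit i i ∈ G.masa := by
  intro k l hkl
  rw [entry_unit, if_neg]
  rintro ⟨rfl, rfl⟩
  exact hkl rfl

lemma masa_le (G : FiniteDigraph) {a : G.Mat} (ha : a ∈ G.masa) : a ∈ G.algebra :=
  fun i j h => ha i j fun hij => h (hij ▸ G.refl i)

lemma unit_mem_normalisers {i j : Fin G.size} (h : G.edge i j) :
    G.unit i j ∈ normalisers G.algebra G.masa := by
  refine ⟨unit_mem_algebra h, by rw [star_unit, unit_mul_unit, unit_mul_unit], fun c _ => ?_⟩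
  rw [star_unit, unit_mul_mul_unit, unit_mul_mul_unit]
  exact ⟨SMulMemClass.smul_mem _ (unit_mem_masa _), SMulMemClass.smul_mem _ (unit_mem_masa _)⟩

/-- The matrix unit of an edge, as an element of the digraph algebra. -/
def edgeUnit (i j : Fin G.size) (h : G.edge i j) : G.algebra := ⟨G.unit i j, unit_mem_algebra h⟩

lemma sum_edgeUnit_mul (a : G.algebra) : (∑ i, edgeUnit i i (G.refl i)) * a = a := by
  refine Subtype.ext ?_
  have : ((∑ i, edgeUnit i i (G.refl i) : G.algebra) : G.Mat) = ∑ i, G.unit i i :=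
    AddSubmonoidClass.coe_finsetSum _ _
  rw [NonUnitalSubalgebra.coe_mul, this, sum_unit, one_mul]

lemma mul_sum_edgeUnit (a : G.algebra) : a * (∑ i, edgeUnit i i (G.refl i)) = a := by
  refine Subtype.ext ?_
  have : ((∑ i, edgeUnit i i (G.refl i) : G.algebra) : G.Mat) = ∑ i, G.unit i i :=
    AddSubmonoidClass.coe_finsetSum _ _
  rw [NonUnitalSubalgebra.coe_mul, this, sum_unit, mul_one]

lemma eq_sum_edgeUnit (a : G.algebra) [∀ i j, Decidable (G.edge i j)] :
    a = ∑ i, ∑ j, if h : G.edge i j then entry a.1 i j • edgeUnit i j h else 0 := by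
  have h1 : a = (∑ i, edgeUnit i i (G.refl i)) * a * (∑ i, edgeUnit i i (G.refl i)) := by
    rw [sum_edgeUnit_mul, mul_sum_edgeUnit]
  nth_rw 1 [h1]
  rw [Finset.sum_mul, Finset.sum_mul]
  refine Finset.sum_congr rfl fun i _ => ?_
  rw [Finset.mul_sum]
  refine Finset.sum_congr rfl fun j _ => Subtype.ext ?_
  have h2 : ((edgeUnit i i (G.refl i) * a * edgeUnit j j (G.refl j) : G.algebra) : G.Mat) =
    entry a.1 i j • G.unit i j := unit_mul_mul_unit a.1 i i j j
  rw [h2]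
  split_ifs with h
  · rfl
  · rw [a.2 i j h, zero_smul]; rfl

end FiniteDigraph

/-! ### Matrix units obtained from a regular embedding -/

section Embeddings

open FiniteDigraph

variable {D : Type u} [NonUnitalCStarAlgebra D]

/-- Regular star extendible injections of a digraph algebra. -/
structure IsRegularEmbedding {G : FiniteDigraph} {A : NonUnitalSubalgebra ℂ D}
    (C : NonUnitalStarSubalgebra ℂ D) (φ : G.algebra →ₙₐ[ℂ] A) : Prop where
  injective : Function.Injective φ
  isStarExtendible : IsStarExtendible φ
  isRegular : IsRegularMap G.masa C φ

variable {G : FiniteDigraph} {A : NonUnitalSubalgebra ℂ D} {C : NonUnitalStarSubalgebra ℂ D}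
  {φ : G.algebra →ₙₐ[ℂ] A}

/-- The relation on vertices making the images of the matrix units available as normalising
partial isometries of `C`. -/
def IsLinked (C : NonUnitalStarSubalgebra ℂ D)
    (Φ : generatedCStar G.algebra →⋆ₙₐ[ℂ] generatedCStar A) (i j : Fin G.size) : Prop :=
  ∃ h : G.unit i j ∈ generatedCStar G.algebra,
    ((Φ ⟨G.unit i j, h⟩ : generatedCStar A) : D) ∈ NonUnitalStarAlgebra.adjoin ℂ (A : Set D) ∧
    ∀ c ∈ C, ((Φ ⟨G.unit i j, h⟩ : generatedCStar A) : D) * c *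
        star ((Φ ⟨G.unit i j, h⟩ : generatedCStar A) : D) ∈ C ∧
      star ((Φ ⟨G.unit i j, h⟩ : generatedCStar A) : D) * c *
        ((Φ ⟨G.unit i j, h⟩ : generatedCStar A) : D) ∈ C

section Linked

variable (Φ : generatedCStar G.algebra →⋆ₙₐ[ℂ] generatedCStar A)

lemma IsLinked.star_apply {i j : Fin G.size} (h : G.unit i j ∈ generatedCStar G.algebra)
    (h' : G.unit j i ∈ generatedCStar G.algebra) :
    ((Φ ⟨G.unit j i, h'⟩ : generatedCStar A) : D) =
      star ((Φ ⟨G.unit i j, h⟩ : generatedCStar A) : D) := by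
  have h1 : (⟨G.unit j i, h'⟩ : generatedCStar G.algebra) = star ⟨G.unit i j, h⟩ :=
    Subtype.ext (star_unit i j).symm
  rw [h1, map_star]
  rfl

lemma IsLinked.mul_apply {i j k : Fin G.size} (h : G.unit i j ∈ generatedCStar G.algebra)
    (h' : G.unit j k ∈ generatedCStar G.algebra) (h'' : G.unit i k ∈ generatedCStar G.algebra) :
    ((Φ ⟨G.unit i k, h''⟩ : generatedCStar A) : D) =
      ((Φ ⟨G.unit i j, h⟩ : generatedCStar A) : D) *
        ((Φ ⟨G.unit j k, h'⟩ : generatedCStar A) : D) := by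
  have h1 : (⟨G.unit i k, h''⟩ : generatedCStar G.algebra) = ⟨G.unit i j, h⟩ * ⟨G.unit j k, h'⟩ :=
    Subtype.ext (unit_mul_unit i j k).symm
  rw [h1, map_mul]
  rfl

variable {Φ}

lemma isLinked_of_edge (hΦ : ∀ a : G.algebra, (Φ ⟨a, subset_generatedCStar _ a.2⟩ : D) = φ a)
    (hreg : IsRegularMap G.masa C φ) {i j : Fin G.size} (h : G.edge i j) : IsLinked C Φ i j := by
  have hm := hΦ (edgeUnit i j h)
  refine ⟨subset_generatedCStar _ (unit_mem_algebra h), ?_, fun c hc => ?_⟩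
  · exact hm ▸ NonUnitalStarAlgebra.subset_adjoin ℂ _ (φ (edgeUnit i j h)).2
  · have := (hreg (edgeUnit i j h) (unit_mem_normalisers h)).2.2 c hc
    rw [← hm] at this
    exact ⟨this.2, this.1⟩

lemma IsLinked.symm {i j : Fin G.size} (h : IsLinked C Φ i j) : IsLinked C Φ j i := by
  obtain ⟨h1, h2, h3⟩ := h
  have h1' : G.unit j i ∈ generatedCStar G.algebra := star_unit i j ▸ star_mem h1
  refine ⟨h1', ?_, fun c hc => ?_⟩
  · rw [IsLinked.star_apply Φ h1 h1']; exact star_mem h2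
  · rw [IsLinked.star_apply Φ h1 h1', star_star]; exact ⟨(h3 c hc).2, (h3 c hc).1⟩

lemma IsLinked.trans {i j k : Fin G.size} (h : IsLinked C Φ i j) (h' : IsLinked C Φ j k) :
    IsLinked C Φ i k := by
  obtain ⟨h1, h2, h3⟩ := h
  obtain ⟨h1', h2', h3'⟩ := h'
  have h1'' : G.unit i k ∈ generatedCStar G.algebra := unit_mul_unit i j k ▸ mul_mem h1 h1'
  refine ⟨h1'', ?_, fun c hc => ?_⟩
  · rw [IsLinked.mul_apply Φ h1 h1' h1'']; exact mul_mem h2 h2'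
  · rw [IsLinked.mul_apply Φ h1 h1' h1'']
    have h4 := (h3 _ (h3' c hc).1).1
    have h5 := (h3' _ (h3 c hc).2).2
    simp only [star_mul, mul_assoc] at h4 h5 ⊢
    exact ⟨h4, h5⟩

end Linked

/-- A regular embedding provides a normalising system of matrix units whose span contains its
range. -/
theorem IsRegularEmbedding.exists_system (hAC : IsOperatorAlgebraWithMasa A C)
    (hφ : IsRegularEmbedding C φ) :
    ∃ (r : Setoid (Fin G.size)) (e : Fin G.size → Fin G.size → D),
      IsNormalisingSystem A C r e ∧
      (∀ i j (h : G.edge i j), r i j ∧ e i j = φ (edgeUnit i j h)) ∧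
      ∀ a : G.algebra, IsNormalisingSystem.IsSpanned e (φ a : D) ∧
        ∀ i j, e i i * (φ a : D) * e j j = entry a.1 i j • e i j := by
  classical
  obtain ⟨Φ, hΦ⟩ := hφ.isStarExtendible
  -- Regularity gives information only on edges, but the intertwining argument needs an equivalence
  -- relation. Linkedness contains the edges and is closed under adjoints and products, so no paths
  -- need be chosen.
  let r : Setoid (Fin G.size) :=
    ⟨IsLinked C Φ, fun i => isLinked_of_edge hΦ hφ.isRegular (G.refl i), fun h => h.symm,
      fun h h' => h.trans h'⟩
  let e : Fin G.size → Fin G.size → D := fun i j =>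
    if h : IsLinked C Φ i j then (Φ ⟨G.unit i j, h.1⟩ : D) else 0
  have hed : ∀ i j (h : IsLinked C Φ i j), e i j = (Φ ⟨G.unit i j, h.1⟩ : D) :=
    fun i j h => dif_pos h
  have hen : ∀ i j, ¬ IsLinked C Φ i j → e i j = 0 := fun i j h => dif_neg h
  have hee : ∀ i j (h : G.edge i j), r i j ∧ e i j = φ (edgeUnit i j h) := fun i j h =>
    ⟨isLinked_of_edge hΦ hφ.isRegular h, by
      rw [hed i j (isLinked_of_edge hΦ hφ.isRegular h), ← hΦ (edgeUnit i j h)]; rfl⟩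
  have hstar : ∀ i j, star (e i j) = e j i := by
    intro i j
    by_cases h : IsLinked C Φ i j
    · rw [hed i j h, hed j i h.symm, IsLinked.star_apply Φ h.1 h.symm.1]
    · rw [hen i j h, hen j i fun h' => h h'.symm, star_zero]
  have hmul : ∀ i j k, r i j → r j k → e i j * e j k = e i k := by
    intro i j k h h'
    rw [hed i j h, hed j k h', hed i k (IsLinked.trans h h'), ← IsLinked.mul_apply Φ]
  have hproj : ∀ i, IsStarProjection (e i i) := fun i =>
    ⟨hmul i i i (r.refl i) (r.refl i), hstar i i⟩
  have hsys : IsNormalisingSystem A C r e := by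
    refine ⟨hstar, fun i j h => hen i j h, hmul, ?_, ?_, ?_, ?_, ?_⟩
    · intro i j h
      rw [(hee i i (G.refl i)).2, (hee j j (G.refl j)).2, ← NonUnitalSubalgebra.coe_mul, ← map_mul]
      have : edgeUnit i i (G.refl i) * edgeUnit j j (G.refl j) = 0 :=
        Subtype.ext (unit_mul_unit_of_ne i j h)
      rw [this, map_zero, NonUnitalSubalgebra.coe_zero]
    · intro i h
      rw [(hee i i (G.refl i)).2] at h
      have h1 : φ (edgeUnit i i (G.refl i)) = φ 0 := by
        rw [map_zero]; exact Subtype.ext h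
      exact unit_ne_zero i i (congrArg Subtype.val (hφ.injective h1))
    · intro i
      refine hAC.mem_of_isStarProjection (hproj i) ?_
      rw [(hee i i (G.refl i)).2]
      exact hφ.isRegular _ (unit_mem_normalisers (G.refl i))
    · intro i j c hc
      by_cases h : IsLinked C Φ i j
      · rw [← hstar i j, hed i j h]
        exact (h.2.2 c hc).1
      · rw [hen i j h, zero_mul, zero_mul]
        exact zero_mem _
    · intro i j
      by_cases h : IsLinked C Φ i j
      · rw [hed i j h]; exact h.2.1
      · rw [hen i j h]; exact zero_mem _
  have hsum : ∑ i, e i i = φ (∑ i, edgeUnit i i (G.refl i)) := by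
    rw [map_sum, AddSubmonoidClass.coe_finsetSum]
    exact Finset.sum_congr rfl fun i _ => (hee i i (G.refl i)).2
  have hcomp : ∀ (a : G.algebra) i j, e i i * (φ a : D) * e j j = entry a.1 i j • e i j := by
    intro a i j
    rw [(hee i i (G.refl i)).2, (hee j j (G.refl j)).2, ← NonUnitalSubalgebra.coe_mul,
      ← NonUnitalSubalgebra.coe_mul, ← map_mul, ← map_mul]
    by_cases h : G.edge i j
    · rw [(hee i j h).2]
      have : edgeUnit i i (G.refl i) * a * edgeUnit j j (G.refl j) =
          entry a.1 i j • edgeUnit i j h := Subtype.ext (unit_mul_mul_unit a.1 i i j j)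
      rw [this, map_smul]
      rfl
    · have : edgeUnit i i (G.refl i) * a * edgeUnit j j (G.refl j) = 0 := by
        refine Subtype.ext ((unit_mul_mul_unit a.1 i i j j).trans ?_)
        rw [a.2 i j h, zero_smul]; rfl
      rw [this, a.2 i j h, map_zero, zero_smul]
      rfl
  refine ⟨r, e, hsys, hee, fun a => ⟨⟨?_, ?_, fun m l => ⟨_, hcomp a m l⟩⟩, hcomp a⟩⟩
  · rw [hsum, ← NonUnitalSubalgebra.coe_mul, ← map_mul, sum_edgeUnit_mul]
  · rw [hsum, ← NonUnitalSubalgebra.coe_mul, ← map_mul, mul_sum_edgeUnit]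

/-- The elements spanned by a normalising system of matrix units form a star algebra. -/
def IsNormalisingSystem.spanned {ι : Type*} [Fintype ι] {r : Setoid ι} {e : ι → ι → D}
    (he : IsNormalisingSystem A C r e) : NonUnitalStarSubalgebra ℂ D where
  carrier := {b | IsSpanned e b}
  zero_mem' := ⟨mul_zero _, zero_mul _, fun m l => ⟨0, by simp⟩⟩
  add_mem' := by
    intro a b ha hb
    refine ⟨by rw [mul_add, ha.sum_mul, hb.sum_mul], by rw [add_mul, ha.mul_sum, hb.mul_sum],
      fun m l => ?_⟩
    obtain ⟨x, hx⟩ := ha.compress m l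
    obtain ⟨y, hy⟩ := hb.compress m l
    exact ⟨x + y, by rw [mul_add, add_mul, hx, hy, add_smul]⟩
  smul_mem' := by
    intro c b hb
    refine ⟨by rw [mul_smul_comm, hb.sum_mul], by rw [smul_mul_assoc, hb.mul_sum],
      fun m l => ?_⟩
    obtain ⟨x, hx⟩ := hb.compress m l
    exact ⟨c * x, by rw [mul_smul_comm, smul_mul_assoc, hx, smul_smul]⟩
  mul_mem' := by
    intro a b ha hb
    refine ⟨by rw [← mul_assoc, ha.sum_mul], by rw [mul_assoc, hb.mul_sum], fun m l => ?_⟩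
    choose x hx using ha.compress
    choose y hy using hb.compress
    have h1 : e m m * (a * b) * e l l = ∑ j, (e m m * a * e j j) * (e j j * b * e l l) := by
      conv_lhs => rw [← hb.sum_mul, Finset.sum_mul, Finset.mul_sum, Finset.mul_sum, Finset.sum_mul]
      refine Finset.sum_congr rfl fun j _ => ?_
      simp only [mul_assoc]
      rw [← mul_assoc (e j j) (e j j), he.diag_mul_self]
    have h2 : ∀ j, ∃ z : ℂ, (e m m * a * e j j) * (e j j * b * e l l) = z • e m l := by
      intro j
      rw [hx, hy, smul_mul_assoc, mul_smul_comm, smul_smul]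
      by_cases hm : r m j
      · by_cases hl : r j l
        · exact ⟨_, by rw [he.mul_eq _ _ _ hm hl]⟩
        · exact ⟨0, by rw [he.eq_zero j l hl]; simp⟩
      · exact ⟨0, by rw [he.eq_zero m j hm]; simp⟩
    choose z hz using h2
    exact ⟨∑ j, z j, by rw [h1, Finset.sum_smul]; exact Finset.sum_congr rfl fun j _ => hz j⟩
  star_mem' := by
    intro b hb
    have hs := he.isStarProjection_sum.isSelfAdjoint.star_eq
    refine ⟨?_, ?_, fun m l => ?_⟩
    · have := congrArg star hb.mul_sum
      rwa [star_mul, hs] at this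
    · have := congrArg star hb.sum_mul
      rwa [star_mul, hs] at this
    · obtain ⟨x, hx⟩ := hb.compress l m
      refine ⟨star x, ?_⟩
      have := congrArg star hx
      rw [star_mul, star_mul, he.star_eq, he.star_eq, star_smul, he.star_eq] at this
      rw [← this, mul_assoc]

/-- Matrix units of linked vertices may lie outside `A`. Being star polynomials in elements of `A`,
they are still approximated by the star algebras `N k`. -/
lemma exists_tendsto_of_mem_adjoin {N : ℕ → NonUnitalStarSubalgebra ℂ D}
    (hN : ∀ a ∈ A, ∃ y : ℕ → D, (∀ k, y k ∈ N k) ∧ Filter.Tendsto y Filter.atTop (nhds a))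
    {x : D} (hx : x ∈ NonUnitalStarAlgebra.adjoin ℂ (A : Set D)) :
    ∃ y : ℕ → D, (∀ k, y k ∈ N k) ∧ Filter.Tendsto y Filter.atTop (nhds x) := by
  induction hx using NonUnitalStarAlgebra.adjoin_induction with
  | mem x hx => exact hN x hx
  | add x y _ _ hx hy =>
    obtain ⟨a, ha, ha'⟩ := hx
    obtain ⟨b, hb, hb'⟩ := hy
    exact ⟨_, fun k => add_mem (ha k) (hb k), ha'.add hb'⟩
  | zero => exact ⟨fun _ => 0, fun k => zero_mem _, tendsto_const_nhds⟩
  | mul x y _ _ hx hy =>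
    obtain ⟨a, ha, ha'⟩ := hx
    obtain ⟨b, hb, hb'⟩ := hy
    exact ⟨_, fun k => mul_mem (ha k) (hb k), ha'.mul hb'⟩
  | smul c x _ hx =>
    obtain ⟨a, ha, ha'⟩ := hx
    exact ⟨_, fun k => SMulMemClass.smul_mem c (ha k), ha'.const_smul c⟩
  | star x _ hx =>
    obtain ⟨a, ha, ha'⟩ := hx
    exact ⟨_, fun k => star_mem (ha k), ha'.star⟩

end Embeddings

/-! ### Factoring and conjugating regular embeddings -/

section Factorisation

open FiniteDigraph

variable {D : Type u} [NonUnitalCStarAlgebra D]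

lemma eq_sum_diag_of_mem_masa {G : FiniteDigraph} {e : Fin G.size → Fin G.size → D} {x : D}
    {a : G.Mat} (hx : IsNormalisingSystem.IsSpanned e x)
    (hcomp : ∀ i j, e i i * x * e j j = entry a i j • e i j) (ha : a ∈ G.masa) :
    x = ∑ i, entry a i i • e i i := by
  rw [← hx.mul_sum, Finset.mul_sum]
  refine Finset.sum_congr rfl fun j _ => ?_
  rw [← hx.sum_mul, Finset.sum_mul, Finset.sum_mul, Finset.sum_eq_single j _ (by simp), hcomp]
  intro i _ hij
  rw [hcomp, ha i j hij, zero_smul]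

/-- Regularity speaks only of normalisers. Diagonal units go to normalising projections, which
maximality places in `C`, and they span the diagonal. -/
lemma coe_map_masa_mem {G : FiniteDigraph} {A : NonUnitalSubalgebra ℂ D}
    {C : NonUnitalStarSubalgebra ℂ D} {φ : G.algebra →ₙₐ[ℂ] A}
    (hAC : IsOperatorAlgebraWithMasa A C) (hφ : IsRegularEmbedding C φ) {a : G.algebra}
    (ha : (a : G.Mat) ∈ G.masa) : (φ a : D) ∈ C := by
  obtain ⟨r, e, he, hee, hs⟩ := hφ.exists_system hAC
  have h1 := eq_sum_diag_of_mem_masa (hs a).1 (hs a).2 ha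
  rw [h1]
  exact sum_mem fun i _ => SMulMemClass.smul_mem _ (he.diag_mem i)

lemma IsRegularEmbedding.exists_masa_near {G : FiniteDigraph} {A : NonUnitalSubalgebra ℂ D}
    {C : NonUnitalStarSubalgebra ℂ D} {φ : G.algebra →ₙₐ[ℂ] A}
    (hAC : IsOperatorAlgebraWithMasa A C) (hφ : IsRegularEmbedding C φ) {c : D} (hc : c ∈ C)
    (b : G.algebra) : ∃ a : G.algebra, (a : G.Mat) ∈ G.masa ∧ ‖c - φ a‖ ≤ 2 * ‖c - φ b‖ := by
  obtain ⟨r, e, he, hee, hs⟩ := hφ.exists_system hAC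
  have hcoe : ((∑ i, entry b.1 i i • edgeUnit i i (G.refl i) : G.algebra) : G.Mat) =
      ∑ i, entry b.1 i i • G.unit i i := AddSubmonoidClass.coe_finsetSum _ _
  refine ⟨∑ i, entry b.1 i i • edgeUnit i i (G.refl i), ?_, ?_⟩
  · rw [hcoe]
    exact sum_mem fun i _ => SMulMemClass.smul_mem _ (unit_mem_masa i)
  · have h1 : (φ (∑ i, entry b.1 i i • edgeUnit i i (G.refl i)) : D) =
        ∑ i, e i i * (φ b : D) * e i i := by
      rw [map_sum, AddSubmonoidClass.coe_finsetSum]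
      refine Finset.sum_congr rfl fun i _ => ?_
      rw [(hs b).2, (hee i i (G.refl i)).2, map_smul]
      rfl
    rw [h1]
    exact he.norm_sub_pinching_le hAC.comm hc (hs b).1.sum_mul

lemma generatedCStar_eq_adjoin [FiniteDimensional ℂ D] (A : NonUnitalSubalgebra ℂ D) :
    generatedCStar A = NonUnitalStarAlgebra.adjoin ℂ (A : Set D) := by
  have hcl : IsClosed (NonUnitalStarAlgebra.adjoin ℂ (A : Set D) : Set D) :=
    Submodule.closed_of_finiteDimensional
      (NonUnitalStarAlgebra.adjoin ℂ (A : Set D)).toSubmodule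
  exact le_antisymm (NonUnitalStarSubalgebra.topologicalClosure_minimal _ le_rfl hcl)
    (NonUnitalStarSubalgebra.le_topologicalClosure _)

lemma generatedCStar_algebra (G : FiniteDigraph) :
    generatedCStar G.algebra = NonUnitalStarAlgebra.adjoin ℂ (G.algebra : Set G.Mat) := by
  have : FiniteDimensional ℂ G.Mat :=
    inferInstanceAs (FiniteDimensional ℂ (Matrix (Fin G.size) (Fin G.size) ℂ))
  exact generatedCStar_eq_adjoin G.algebra

section Extension

variable {E : Type v} [NonUnitalCStarAlgebra E] {G : FiniteDigraph}
  {B : NonUnitalSubalgebra ℂ E} {φ : G.algebra →ₙₐ[ℂ] B}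
  {Φ : generatedCStar G.algebra →⋆ₙₐ[ℂ] generatedCStar B}

/-- A nonzero element of the kernel, multiplied by matrix units and a scalar, would put some
diagonal unit in the kernel. Diagonal units belong to the digraph algebra, where `φ` is injective.
-/
lemma extension_injective (hΦ : ∀ a : G.algebra, (Φ ⟨a, subset_generatedCStar _ a.2⟩ : E) = φ a)
    (hφ : Function.Injective φ) : Function.Injective Φ := by
  rw [injective_iff_map_eq_zero]
  intro x hx
  by_contra hne
  obtain ⟨i, j, hij⟩ : ∃ i j, entry x.1 i j ≠ 0 := by
    by_contra! h
    exact hne (Subtype.ext (mat_ext h))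
  have hi : ∀ i, G.unit i i ∈ generatedCStar G.algebra := fun i =>
    subset_generatedCStar _ (unit_mem_algebra (G.refl i))
  have hu : G.unit i j ∈ generatedCStar G.algebra := by
    have := mul_mem (mul_mem (hi i) x.2) (hi j)
    rw [unit_mul_mul_unit] at this
    have h2 := SMulMemClass.smul_mem (entry x.1 i j)⁻¹ this
    rwa [smul_smul, inv_mul_cancel₀ hij, one_smul] at h2
  have h1 : (⟨G.unit i i, hi i⟩ : generatedCStar G.algebra) =
      (entry x.1 i j)⁻¹ • (⟨G.unit i i, hi i⟩ * x * star ⟨G.unit i j, hu⟩) := by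
    refine Subtype.ext ?_
    change G.unit i i = (entry x.1 i j)⁻¹ • (G.unit i i * x.1 * star (G.unit i j))
    rw [star_unit, unit_mul_mul_unit, smul_smul, inv_mul_cancel₀ hij, one_smul]
  have h2 : Φ ⟨G.unit i i, hi i⟩ = 0 := by
    rw [h1, map_smul, map_mul, map_mul, hx, mul_zero, zero_mul, smul_zero]
  have h3 : φ (edgeUnit i i (G.refl i)) = φ 0 := by
    rw [map_zero]
    refine Subtype.ext ?_
    rw [← hΦ]
    exact congrArg Subtype.val h2
  exact unit_ne_zero i i (congrArg Subtype.val (hφ h3))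

/-- Commuting with the images of the diagonal units pulls back through the injective extension, and
a matrix commuting with all diagonal units is diagonal. -/
lemma mem_masa_of_extension_mem {C : NonUnitalStarSubalgebra ℂ E}
    (hBC : IsOperatorAlgebraWithMasa B C) (hφ : IsRegularEmbedding C φ)
    (hΦ : ∀ a : G.algebra, (Φ ⟨a, subset_generatedCStar _ a.2⟩ : E) = φ a)
    {x : generatedCStar G.algebra} (hx : (Φ x : E) ∈ C) : (x : G.Mat) ∈ G.masa := by
  intro i j hij
  have hj : G.unit j j ∈ generatedCStar G.algebra :=
    subset_generatedCStar _ (unit_mem_algebra (G.refl j))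
  have hC : ((Φ ⟨G.unit j j, hj⟩ : generatedCStar B) : E) ∈ C := by
    have := coe_map_masa_mem hBC hφ (a := edgeUnit j j (G.refl j)) (unit_mem_masa j)
    rwa [← hΦ] at this
  have h1 : x * ⟨G.unit j j, hj⟩ = ⟨G.unit j j, hj⟩ * x := by
    refine extension_injective hΦ hφ.injective (Subtype.ext ?_)
    rw [map_mul, map_mul]
    exact hBC.comm _ hx _ hC
  have h2 : (x : G.Mat) * G.unit j j = G.unit j j * x := congrArg Subtype.val h1
  have h3 : entry (x : G.Mat) i j • G.unit i j = 0 := by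
    rw [← unit_mul_mul_unit, mul_assoc, h2, ← mul_assoc, unit_mul_unit_of_ne i j hij, zero_mul]
  exact (smul_eq_zero.1 h3).resolve_right (unit_ne_zero i j)

end Extension

variable {A : NonUnitalSubalgebra ℂ D} {C : NonUnitalStarSubalgebra ℂ D}

/-- A regular embedding whose range contains that of another one factors it. -/
theorem exists_factorisation (hAC : IsOperatorAlgebraWithMasa A C) {G H : FiniteDigraph}
    {φ : G.algebra →ₙₐ[ℂ] A} {ψ : H.algebra →ₙₐ[ℂ] A} (hφ : IsRegularEmbedding C φ)
    (hψ : IsRegularEmbedding C ψ) (hrange : ∀ a, ∃ b, ψ b = φ a) :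
    ∃ χ : G.algebra →ₙₐ[ℂ] H.algebra, IsRegularEmbedding H.masa χ ∧ ∀ a, ψ (χ a) = φ a := by
  choose g hg using hrange
  have hinj := hψ.injective
  let χ : G.algebra →ₙₐ[ℂ] H.algebra :=
    { toFun := g
      map_smul' := fun c x => hinj (by rw [hg, MonoidHom.id_apply, map_smul, map_smul, hg])
      map_zero' := hinj (by rw [hg, map_zero, map_zero])
      map_add' := fun x y => hinj (by rw [hg, map_add, map_add, hg, hg])
      map_mul' := fun x y => hinj (by rw [hg, map_mul, map_mul, hg, hg]) }
  have hχ : ∀ a, ψ (χ a) = φ a := hg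
  obtain ⟨Φ, hΦ⟩ := hφ.isStarExtendible
  obtain ⟨Ψ, hΨ⟩ := hψ.isStarExtendible
  have hΨinj := extension_injective hΨ hψ.injective
  -- Containment of ranges passes to algebraic star algebras by induction; in finite dimension the
  -- closure adds nothing.
  have hR : ∀ x : generatedCStar G.algebra, ∃ y, Ψ y = Φ x := by
    have key : ∀ x (hx : x ∈ NonUnitalStarAlgebra.adjoin ℂ (G.algebra : Set G.Mat)),
        ∃ y, Ψ y = Φ ⟨x, adjoin_le_generatedCStar _ hx⟩ := by
      intro x hx
      induction hx using NonUnitalStarAlgebra.adjoin_induction with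
      | mem x hx =>
        refine ⟨⟨χ ⟨x, hx⟩, subset_generatedCStar _ (χ ⟨x, hx⟩).2⟩, Subtype.ext ?_⟩
        rw [hΨ, hχ]
        exact (hΦ ⟨x, hx⟩).symm
      | add x y hx hy ihx ihy =>
        obtain ⟨a, ha⟩ := ihx
        obtain ⟨b, hb⟩ := ihy
        exact ⟨a + b, by rw [map_add, ha, hb, ← map_add]; rfl⟩
      | zero => exact ⟨0, by rw [map_zero]; exact (map_zero Φ).symm⟩
      | mul x y hx hy ihx ihy =>
        obtain ⟨a, ha⟩ := ihx
        obtain ⟨b, hb⟩ := ihy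
        exact ⟨a * b, by rw [map_mul, ha, hb, ← map_mul]; rfl⟩
      | smul c x hx ihx =>
        obtain ⟨a, ha⟩ := ihx
        exact ⟨c • a, by rw [map_smul, ha, ← map_smul]; rfl⟩
      | star x hx ihx =>
        obtain ⟨a, ha⟩ := ihx
        exact ⟨star a, by rw [map_star, ha, ← map_star]; rfl⟩
    intro x
    exact key x.1 ((generatedCStar_algebra G) ▸ x.2)
  choose k hk using hR
  let X : generatedCStar G.algebra →⋆ₙₐ[ℂ] generatedCStar H.algebra :=
    { toFun := k
      map_smul' := fun c x => hΨinj (by rw [hk, MonoidHom.id_apply, map_smul, map_smul, hk])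
      map_zero' := hΨinj (by rw [hk, map_zero, map_zero])
      map_add' := fun x y => hΨinj (by rw [hk, map_add, map_add, hk, hk])
      map_mul' := fun x y => hΨinj (by rw [hk, map_mul, map_mul, hk, hk])
      map_star' := fun x => hΨinj (by rw [hk, map_star, map_star, hk]) }
  have hX : ∀ x, Ψ (X x) = Φ x := hk
  have hXχ : ∀ a : G.algebra, X ⟨a, subset_generatedCStar _ a.2⟩ =
      ⟨χ a, subset_generatedCStar _ (χ a).2⟩ := by
    intro a
    refine hΨinj (Subtype.ext ?_)
    rw [hX, hΦ, hΨ, hχ]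
  refine ⟨χ, ⟨fun a b h => hφ.injective ?_, ⟨X, fun a => by rw [hXχ]⟩, fun w hw => ?_⟩, hχ⟩
  · rw [← hχ, ← hχ, h]
  · have hn := hφ.isRegular w hw
    rw [← hχ, ← hΨ] at hn
    set v : generatedCStar H.algebra := ⟨χ w, subset_generatedCStar _ (χ w).2⟩ with hv
    refine ⟨(χ w).2, ?_, fun c hc => ?_⟩
    · have : v * star v * v = v := by
        refine hΨinj (Subtype.ext ?_)
        rw [map_mul, map_mul, map_star]
        exact hn.2.1
      exact congrArg Subtype.val this
    · have hcm := masa_le H hc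
      have hcC := coe_map_masa_mem hAC hψ (a := ⟨c, hcm⟩) hc
      rw [← hΨ] at hcC
      have h1 := hn.2.2 _ hcC
      set d : generatedCStar H.algebra := ⟨c, subset_generatedCStar _ hcm⟩ with hd
      have h2 : ((Ψ (star v * d * v) : generatedCStar A) : D) ∈ C := by
        rw [map_mul, map_mul, map_star]
        exact h1.1
      have h3 : ((Ψ (v * d * star v) : generatedCStar A) : D) ∈ C := by
        rw [map_mul, map_mul, map_star]
        exact h1.2
      exact ⟨mem_masa_of_extension_mem hAC hψ hΨ h2, mem_masa_of_extension_mem hAC hψ hΨ h3⟩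

/-- Conjugation of a regular embedding by a partial unitary of `C` supported on the image of the
identity. -/
theorem IsRegularEmbedding.exists_conj (hAC : IsOperatorAlgebraWithMasa A C) {G : FiniteDigraph}
    {φ : G.algebra →ₙₐ[ℂ] A} (hφ : IsRegularEmbedding C φ) {u : D} (hu : u ∈ C)
    (hl : star u * u = (φ (∑ i, edgeUnit i i (G.refl i)) : D)) :
    ∃ ψ : G.algebra →ₙₐ[ℂ] A, IsRegularEmbedding C ψ ∧ ∀ a, (ψ a : D) = u * φ a * star u := by
  -- The inclusion `C ⊆ A` keeps the conjugated map inside the non-self-adjoint algebra `A`.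
  have huA : u ∈ A := hAC.masa_le u hu
  have husA : star u ∈ A := hAC.masa_le _ (star_mem hu)
  have hleft : ∀ a, star u * u * (φ a : D) = φ a := fun a => by
    rw [hl, ← NonUnitalSubalgebra.coe_mul, ← map_mul, sum_edgeUnit_mul]
  have hright : ∀ a, (φ a : D) * (star u * u) = φ a := fun a => by
    rw [hl, ← NonUnitalSubalgebra.coe_mul, ← map_mul, mul_sum_edgeUnit]
  have hcancel : ∀ a, star u * (u * (φ a : D) * star u) * u = φ a := fun a => by
    calc star u * (u * (φ a : D) * star u) * u
        = (star u * u * (φ a : D)) * (star u * u) := by simp only [mul_assoc]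
      _ = φ a := by rw [hleft, hright]
  have hmul : ∀ x y : D, x * (star u * u) = x →
      u * (x * y) * star u = (u * x * star u) * (u * y * star u) := fun x y hx => by
    calc u * (x * y) * star u = u * ((x * (star u * u)) * y) * star u := by rw [hx]
      _ = _ := by simp only [mul_assoc]
  let ψ : G.algebra →ₙₐ[ℂ] A :=
    { toFun := fun a => ⟨u * φ a * star u, mul_mem (mul_mem huA (φ a).2) husA⟩
      map_smul' := fun c x => Subtype.ext (by simp [mul_smul_comm, smul_mul_assoc])
      map_zero' := Subtype.ext (by simp)
      map_add' := fun x y => Subtype.ext (by simp [mul_add, add_mul])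
      map_mul' := fun x y => Subtype.ext (by
        simp only [map_mul, NonUnitalSubalgebra.coe_mul]
        exact hmul _ _ (hright x)) }
  have hψ : ∀ a, (ψ a : D) = u * φ a * star u := fun a => rfl
  obtain ⟨Φ, hΦ⟩ := hφ.isStarExtendible
  have hMC : ∀ c ∈ C, c ∈ generatedCStar A := fun c hc => hAC.isMasa.prop.1 hc
  have hΦright : ∀ x, (Φ x : D) * (star u * u) = Φ x := by
    intro x
    rw [hl, ← hΦ]
    have : x * ⟨(∑ i, edgeUnit i i (G.refl i) : G.algebra),
        subset_generatedCStar _ (∑ i, edgeUnit i i (G.refl i) : G.algebra).2⟩ = x := by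
      refine Subtype.ext ?_
      have h1 : ((∑ i, edgeUnit i i (G.refl i) : G.algebra) : G.Mat) = ∑ i, G.unit i i :=
        AddSubmonoidClass.coe_finsetSum _ _
      change (x : G.Mat) * ((∑ i, edgeUnit i i (G.refl i) : G.algebra) : G.Mat) = x
      rw [h1, sum_unit, mul_one]
    conv_rhs => rw [← this, map_mul]
    rfl
  let Ψ : generatedCStar G.algebra →⋆ₙₐ[ℂ] generatedCStar A :=
    { toFun := fun x => ⟨u * Φ x * star u,
        mul_mem (mul_mem (hMC u hu) (Φ x).2) (star_mem (hMC u hu))⟩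
      map_smul' := fun c x => Subtype.ext (by simp [mul_smul_comm, smul_mul_assoc])
      map_zero' := Subtype.ext (by simp)
      map_add' := fun x y => Subtype.ext (by simp [mul_add, add_mul])
      map_mul' := fun x y => Subtype.ext (by
        rw [map_mul]
        exact hmul _ _ (hΦright x))
      map_star' := fun x => Subtype.ext (by
        rw [map_star]
        simp [mul_assoc]) }
  refine ⟨ψ, ⟨fun a b h => hφ.injective (Subtype.ext ?_), ⟨Ψ, fun a => ?_⟩, fun w hw => ?_⟩, hψ⟩
  · have h1 : u * (φ a : D) * star u = u * (φ b : D) * star u := congrArg Subtype.val h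
    rw [← hcancel a, h1, hcancel]
  · change u * (Φ ⟨a, _⟩ : D) * star u = u * φ a * star u
    rw [hΦ]
  · have hn := hφ.isRegular w hw
    have hrw := hright w
    have hlw := hleft w
    refine ⟨(ψ w).2, ?_, fun c hc => ?_⟩
    · rw [hψ]
      calc u * (φ w : D) * star u * star (u * (φ w : D) * star u) * (u * (φ w : D) * star u)
          = u * ((φ w : D) * (star u * u) * star (φ w : D) * (star u * u * (φ w : D))) *
              star u := by simp only [star_mul, star_star, mul_assoc]
        _ = _ := by rw [hrw, hlw, hn.2.1]
    · rw [hψ]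
      have h1 := hn.2.2 _ (mul_mem (mul_mem (star_mem hu) hc) hu)
      constructor
      · have := mul_mem (mul_mem hu h1.1) (star_mem hu)
        simpa [mul_assoc] using this
      · have := mul_mem (mul_mem hu h1.2) (star_mem hu)
        simpa [mul_assoc] using this

end Factorisation

/-! ### Extending an embedding to one with nearly full range -/

section Limit

open FiniteDigraph Filter Topology

variable {D : Type u} [NonUnitalCStarAlgebra D] {A : NonUnitalSubalgebra ℂ D}
  {C : NonUnitalStarSubalgebra ℂ D}

/-- Elements of `C*(A)` commuting with the projections of `C` lie in `C` if the diagonal algebras of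
regular embeddings exhaust `C`. -/
lemma mem_masa_of_commute_projections (hAC : IsOperatorAlgebraWithMasa A C)
    {G : ℕ → FiniteDigraph} {φ : ∀ k, (G k).algebra →ₙₐ[ℂ] A}
    (hφ : ∀ k, IsRegularEmbedding C (φ k))
    (hlim : ∀ a ∈ A, ∃ b : ∀ k, (G k).algebra, Tendsto (fun k => (φ k (b k) : D)) atTop (𝓝 a))
    {d : D} (hd : d ∈ generatedCStar A)
    (hcomm : ∀ q ∈ C, IsStarProjection q → d * q = q * d) : d ∈ C := by
  refine hAC.isMasa.mem_of_commute hd fun c hc => ?_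
  obtain ⟨b, hb⟩ := hlim c (hAC.masa_le c hc)
  choose a ham ha using fun k => (hφ k).exists_masa_near hAC hc (b k)
  have hda : ∀ k, d * (φ k (a k) : D) = (φ k (a k) : D) * d := by
    intro k
    obtain ⟨r, e, he, hee, hs⟩ := (hφ k).exists_system hAC
    have h1 := eq_sum_diag_of_mem_masa (hs (a k)).1 (hs (a k)).2 (ham k)
    rw [h1, Finset.mul_sum, Finset.sum_mul]
    refine Finset.sum_congr rfl fun i _ => ?_
    rw [mul_smul_comm, smul_mul_assoc, hcomm _ (he.diag_mem i) (he.isStarProjection i)]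
  have hlim' : Tendsto (fun k => (φ k (a k) : D)) atTop (𝓝 c) := by
    rw [tendsto_iff_norm_sub_tendsto_zero] at hb ⊢
    refine squeeze_zero (fun _ => norm_nonneg _) (fun k => ?_) (by simpa using hb.const_mul 2)
    rw [norm_sub_rev, norm_sub_rev (φ k (b k) : D)]
    exact ha k
  refine tendsto_nhds_unique (hlim'.const_mul d) ?_
  simpa only [hda] using hlim'.mul_const d

/-- A regular embedding factors through a regular embedding whose range is nearly everything. -/
theorem exists_extension (hAC : IsOperatorAlgebraWithMasa A C)
    {G : ℕ → FiniteDigraph} {φ : ∀ k, (G k).algebra →ₙₐ[ℂ] A}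
    (hφ : ∀ k, IsRegularEmbedding C (φ k))
    (hlim : ∀ a ∈ A, ∃ b : ∀ k, (G k).algebra, Tendsto (fun k => (φ k (b k) : D)) atTop (𝓝 a))
    {G₁ : FiniteDigraph} {φ₁ : G₁.algebra →ₙₐ[ℂ] A} (hφ₁ : IsRegularEmbedding C φ₁)
    {T : Set D} (hT : T.Finite) (hTA : T ⊆ A) {ε : ℝ} (hε : 0 < ε) :
    ∃ (H : FiniteDigraph) (ψ : H.algebra →ₙₐ[ℂ] A) (χ : G₁.algebra →ₙₐ[ℂ] H.algebra),
      IsRegularEmbedding C ψ ∧ IsRegularEmbedding H.masa χ ∧ (∀ a, ψ (χ a) = φ₁ a) ∧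
      ∀ s ∈ T, ∃ b, ‖s - (ψ b : D)‖ < ε := by
  classical
  have hC := hAC.comm
  obtain ⟨s, f, hf, hff, -⟩ := hφ₁.exists_system hAC
  choose r e he hee hes using fun k => (hφ k).exists_system hAC
  obtain ⟨M, hM0, hM⟩ : ∃ M : ℝ, 0 ≤ M ∧ ∀ t ∈ T, ‖t‖ ≤ M := by
    obtain ⟨M, hM⟩ := hT.isBounded.exists_norm_le
    exact ⟨max M 0, le_max_right _ _, fun t ht => (hM t ht).trans (le_max_left _ _)⟩
  -- The value `1 / 2` serves rigidity. The other value makes the cost of conjugation, at most `5 /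
  -- 2 * (η * (M + 1))`, no more than `5 * ε / 16`, leaving room for `δ ≤ ε / 2`.
  set η : ℝ := min (1 / 2) (ε / (8 * (M + 1))) with hη_def
  have hη0 : 0 < η := lt_min (by norm_num) (by positivity)
  have hη : η ≤ 1 / 2 := min_le_left _ _
  have hηε : η * (M + 1) ≤ ε / 8 := by
    have := min_le_right (1 / 2) (ε / (8 * (M + 1)))
    calc η * (M + 1) ≤ ε / (8 * (M + 1)) * (M + 1) := by gcongr
      _ = ε / 8 := by field_simp
  set δ : ℝ := min (1 / 2) (ε / 2) with hδ_def
  have hδ0 : 0 < δ := lt_min (by norm_num) (by positivity)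
  have happ : ∀ i j, ∃ y : ℕ → D, (∀ k, y k ∈ (he k).spanned) ∧
      Tendsto y atTop (𝓝 (f i j)) := fun i j => by
    refine exists_tendsto_of_mem_adjoin (fun a ha => ?_) (hf.mem_adjoin i j)
    obtain ⟨b, hb⟩ := hlim a ha
    exact ⟨_, fun k => (hes k (b k)).1, hb⟩
  choose y hy hylim using happ
  choose! b hb using hlim
  have hev1 : ∀ᶠ k in atTop, ∀ i j, ‖f i j - y i j k‖ < η := by
    refine eventually_all.2 fun i => eventually_all.2 fun j => ?_
    filter_upwards [(Metric.tendsto_nhds.1 (hylim i j)) η hη0] with k hk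
    rwa [← dist_eq_norm, dist_comm]
  have hev2 : ∀ S : Set D, S.Finite → S ⊆ A →
      ∀ᶠ k in atTop, ∀ a ∈ S, ‖a - φ k (b a k)‖ < δ := by
    intro S hS hSA
    refine (hS.eventually_all).2 fun a ha => ?_
    filter_upwards [(Metric.tendsto_nhds.1 (hb a (hSA ha))) δ hδ0] with k hk
    rwa [← dist_eq_norm, dist_comm]
  -- The elements `y i j k` live only in the star algebra spanned by `e k`. Edge units are also
  -- approximated from the range of `φ k` itself, which is what detects edges.
  let F : Set D := Set.range fun p : {p : Fin G₁.size × Fin G₁.size // G₁.edge p.1 p.2} =>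
    f p.1.1 p.1.2
  have hFA : F ⊆ A := by
    rintro _ ⟨⟨⟨i, j⟩, h⟩, rfl⟩
    change f i j ∈ A
    rw [(hff i j h).2]
    exact (φ₁ (edgeUnit i j h)).2
  obtain ⟨k, hk1, hk2, hk3⟩ :=
    (hev1.and ((hev2 T hT hTA).and (hev2 F (Set.finite_range _) hFA))).exists
  obtain ⟨u, huC, hl, hr, ⟨μ, hμ⟩, hu⟩ := hf.exists_intertwining_unitary (he k) hC
    (fun d hd h => mem_masa_of_commute_projections hAC hφ
      (fun a ha => ⟨b a, hb a ha⟩) hd h) hη0 hη (fun i j => hy i j k) hk1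
  have hsum : (φ k (∑ i, edgeUnit i i ((G k).refl i)) : D) = ∑ i, e k i i := by
    rw [map_sum, AddSubmonoidClass.coe_finsetSum]
    exact Finset.sum_congr rfl fun i _ => ((hee k i i ((G k).refl i)).2).symm
  obtain ⟨ψ, hψ, hψu⟩ := (hφ k).exists_conj hAC huC (hl.trans hsum.symm)
  have hedge : ∀ i j (h : G₁.edge i j), ∃ c, ψ c = φ₁ (edgeUnit i j h) := by
    intro i j h
    obtain ⟨h1, h2⟩ := hu i j (hff i j h).1
    have hpiece : ∀ l, ∃ c, (ψ c : D) = f i j * e k l l := by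
      intro l
      obtain h0 | ⟨m, hm, hml⟩ := h2 l
      · exact ⟨0, by rw [h0, map_zero]; rfl⟩
      -- Off the edges, the compression of an element of the range of `φ k` vanishes, whereas that
      -- of `f i j` has norm one; the two are within `1 / 2`.
      have hedge : (G k).edge m l := by
        by_contra hne
        set z := b (f i j) k with hz
        have h3 : e k m m * (φ k z : D) * e k l l = 0 := by
          rw [(hes k z).2, z.2 m l hne, zero_smul]
        have h4 : IsNormalising C (e k m m * f i j * e k l l) :=
          (((he k).isNormalising m m).mul hC (hf.isNormalising i j)).mul hC
            ((he k).isNormalising l l)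
        have h5 : ‖e k m m * (f i j - φ k z) * e k l l‖ ≤ ‖f i j - φ k z‖ :=
          (norm_mul_isStarProjection_le _ ((he k).isStarProjection l)).trans
            (norm_isStarProjection_mul_le _ ((he k).isStarProjection m))
        rw [mul_sub, sub_mul, h3, sub_zero, h4.norm_eq_one hm] at h5
        have h6 := hk3 (f i j) ⟨⟨⟨i, j⟩, h⟩, rfl⟩
        have h7 : δ ≤ 1 / 2 := min_le_left _ _
        linarith
      exact ⟨edgeUnit m l hedge, by rw [hψu, hml, (hee k m l hedge).2]⟩
    choose c hc using hpiece
    refine ⟨∑ l, c l, Subtype.ext ?_⟩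
    rw [map_sum, AddSubmonoidClass.coe_finsetSum, Finset.sum_congr rfl fun l _ => hc l,
      ← Finset.mul_sum, h1, (hff i j h).2]
  have hrange : ∀ a, ∃ c, ψ c = φ₁ a := by
    intro a
    choose g hg using hedge
    refine ⟨∑ i, ∑ j, if h : G₁.edge i j then entry a.1 i j • g i j h else 0, ?_⟩
    conv_rhs => rw [eq_sum_edgeUnit a]
    simp only [map_sum]
    refine Finset.sum_congr rfl fun i _ => Finset.sum_congr rfl fun j _ => ?_
    split_ifs with h
    · rw [map_smul, map_smul, hg]
    · rw [map_zero, map_zero]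
  obtain ⟨χ, hχ, hχψ⟩ := exists_factorisation hAC hφ₁ hψ hrange
  refine ⟨G k, ψ, χ, hψ, hχ, hχψ, fun t ht => ?_⟩
  -- `W` maps to the diagonal element `w` near `u`, so `u * star w * B * w * star u` is close to
  -- `B`. Being diagonal, `W` and `W'` stay in the digraph algebra, where `star u * B * u` might
  -- have no preimage.
  let W : (G k).algebra := ∑ l, μ l • edgeUnit l l ((G k).refl l)
  let W' : (G k).algebra := ∑ l, star (μ l) • edgeUnit l l ((G k).refl l)
  have hcoe : ∀ ν : Fin (G k).size → ℂ,
      (φ k (∑ l, ν l • edgeUnit l l ((G k).refl l)) : D) = ∑ l, ν l • e k l l := by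
    intro ν
    rw [map_sum, AddSubmonoidClass.coe_finsetSum]
    refine Finset.sum_congr rfl fun l _ => ?_
    rw [map_smul, (hee k l l ((G k).refl l)).2]
    rfl
  set w : D := ∑ l, μ l • e k l l with hw
  have hW : (φ k W : D) = w := hcoe μ
  have hW' : (φ k W' : D) = star w := by
    rw [hw, star_sum]
    refine (hcoe fun l => star (μ l)).trans (Finset.sum_congr rfl fun l _ => ?_)
    rw [star_smul, (he k).star_eq]
  set β := b t k with hβ
  set B : D := ((φ k β : A) : D) with hB
  have htB : ‖t - B‖ < δ := hk2 t ht
  have hBn : ‖B‖ ≤ M + 1 := by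
    have h1 : ‖B‖ ≤ ‖t‖ + ‖t - B‖ := by
      simpa [norm_sub_rev] using norm_add_le t (B - t)
    have h7 : δ ≤ 1 / 2 := min_le_left _ _
    linarith [hM t ht]
  have hun : ‖u‖ ≤ 1 :=
    norm_le_one_of_isStarProjection (hl ▸ (he k).isStarProjection_sum)
  have hwn : ‖w‖ ≤ 3 / 2 := by
    have h1 : ‖w‖ ≤ ‖u‖ + ‖u - w‖ := by
      simpa [norm_sub_rev] using norm_add_le u (w - u)
    linarith
  refine ⟨W' * β * W, ?_⟩
  have hval : (ψ (W' * β * W) : D) = u * (star w * B * w) * star u := by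
    rw [hψu, map_mul, map_mul, NonUnitalSubalgebra.coe_mul, NonUnitalSubalgebra.coe_mul, hW, hW']
  have hBu : B = u * (star u * B * u) * star u := by
    calc B = (∑ i, e k i i) * B * ∑ i, e k i i := by
          rw [(hes k β).1.sum_mul, (hes k β).1.mul_sum]
      _ = _ := by rw [← hr]; simp only [mul_assoc]
  have hdiff : B - ψ (W' * β * W) =
      u * (star (u - w) * B * u + star w * B * (u - w)) * star u := by
    rw [hval]
    nth_rw 1 [hBu]
    rw [← sub_mul, ← mul_sub]
    congr 2
    rw [star_sub]
    simp only [sub_mul, mul_sub]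
    abel
  have hd : ‖B - ψ (W' * β * W)‖ ≤ 5 / 2 * (η * (M + 1)) := by
    rw [hdiff]
    have h1 : ‖star (u - w) * B * u‖ ≤ η * (M + 1) * 1 := by
      refine (norm_mul_le _ _).trans (mul_le_mul ((norm_mul_le _ _).trans ?_) hun
        (norm_nonneg _) (by positivity))
      rw [norm_star]
      exact mul_le_mul hμ hBn (norm_nonneg _) hη0.le
    have h2 : ‖star w * B * (u - w)‖ ≤ 3 / 2 * (M + 1) * η := by
      refine (norm_mul_le _ _).trans (mul_le_mul ((norm_mul_le _ _).trans ?_) hμ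
        (norm_nonneg _) (by positivity))
      rw [norm_star]
      exact mul_le_mul hwn hBn (norm_nonneg _) (by norm_num)
    have h3 : ‖star (u - w) * B * u + star w * B * (u - w)‖ ≤ 5 / 2 * (η * (M + 1)) := by
      refine (norm_add_le _ _).trans ?_
      linarith
    refine (norm_mul_le _ _).trans ?_
    rw [norm_star]
    refine (mul_le_of_le_one_right (norm_nonneg _) hun).trans ?_
    exact (norm_mul_le _ _).trans
      ((mul_le_of_le_one_left (norm_nonneg _) hun).trans h3)
  have hδε : δ ≤ ε / 2 := min_le_right _ _
  calc ‖t - ψ (W' * β * W)‖ ≤ ‖t - B‖ + ‖B - ψ (W' * β * W)‖ :=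
        norm_sub_le_norm_sub_add_norm_sub _ _ _
    _ < ε := by linarith

end Limit

/-! ### Limits and local approximation -/

section Characterisation

open FiniteDigraph Filter Topology

/-- This lets the results on regular embeddings apply to the connecting maps as well. -/
lemma FiniteDigraph.isOperatorAlgebraWithMasa (G : FiniteDigraph) :
    IsOperatorAlgebraWithMasa G.algebra G.masa := by
  have : FiniteDimensional ℂ G.Mat :=
    inferInstanceAs (FiniteDimensional ℂ (Matrix (Fin G.size) (Fin G.size) ℂ))
  refine ⟨?_, fun c hc => G.masa_le hc, ⟨⟨fun c hc => subset_generatedCStar _ (G.masa_le hc), ?_⟩,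
    ?_⟩⟩
  · exact Submodule.closed_of_finiteDimensional G.algebra.toSubmodule
  · intro x hx y hy
    refine mat_ext fun i j => ?_
    rw [entry_mul, entry_mul]
    refine Finset.sum_congr rfl fun k _ => ?_
    by_cases hik : i = k
    · by_cases hkj : k = j
      · rw [hik, hkj, mul_comm]
      · rw [hx k j hkj, hy k j hkj, mul_zero, mul_zero]
    · rw [hx i k hik, hy i k hik, zero_mul, zero_mul]
  · intro S hS hle x hx i j hij
    have h1 := hS.2 x hx _ (hle (unit_mem_masa j))
    have h3 : entry x i j • G.unit i j = 0 := by
      rw [← unit_mul_mul_unit, mul_assoc, h1, ← mul_assoc, unit_mul_unit_of_ne i j hij, zero_mul]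
    exact (smul_eq_zero.1 h3).resolve_right (unit_ne_zero i j)

variable {D : Type u} [NonUnitalCStarAlgebra D] {A : NonUnitalSubalgebra ℂ D}
  {C : NonUnitalStarSubalgebra ℂ D}

/-- The maps from the building blocks of a regular limit into the limit are regular. -/
theorem isRegularMap_of_limit
    {G : ℕ → FiniteDigraph} {φ : ∀ k, (G k).algebra →ₙₐ[ℂ] (G (k + 1)).algebra}
    {ψ : ∀ k, (G k).algebra →ₙₐ[ℂ] A}
    (hφ : ∀ k, IsRegularEmbedding (G (k + 1)).masa (φ k))
    (hψ : ∀ k, IsStarExtendible (ψ k)) (hcomp : ∀ k a, ψ (k + 1) (φ k a) = ψ k a)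
    (hC : (C : Set D) = closure
      (⋃ k, {x : D | ∃ a : (G k).algebra, (a : (G k).Mat) ∈ (G k).masa ∧ (ψ k a : D) = x}))
    (k : ℕ) : IsRegularMap (G k).masa C (ψ k) := by
  intro w hw
  have hlift : ∀ m, k ≤ m → ∃ w' : (G m).algebra,
      (w' : (G m).Mat) ∈ normalisers (G m).algebra (G m).masa ∧ ψ m w' = ψ k w := by
    intro m hm
    induction m, hm using Nat.le_induction with
    | base => exact ⟨w, hw, rfl⟩
    | succ m _ ih =>
      obtain ⟨w', h1, h2⟩ := ih
      exact ⟨φ m w', (hφ m).isRegular w' h1, by rw [hcomp, h2]⟩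
  have hliftC : ∀ j (c : (G j).algebra), (c : (G j).Mat) ∈ (G j).masa → ∀ m, j ≤ m →
      ∃ c' : (G m).algebra, (c' : (G m).Mat) ∈ (G m).masa ∧ ψ m c' = ψ j c := by
    intro j c hc m hm
    induction m, hm using Nat.le_induction with
    | base => exact ⟨c, hc, rfl⟩
    | succ m _ ih =>
      obtain ⟨c', h1, h2⟩ := ih
      exact ⟨φ m c', coe_map_masa_mem (G (m + 1)).isOperatorAlgebraWithMasa (hφ m) h1,
        by rw [hcomp, h2]⟩
  have hmem : ∀ m (c : (G m).algebra), (c : (G m).Mat) ∈ (G m).masa → (ψ m c : D) ∈ C := by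
    intro m c hc
    rw [← SetLike.mem_coe, hC]
    exact subset_closure (Set.mem_iUnion.2 ⟨m, c, hc, rfl⟩)
  refine ⟨(ψ k w).2, ?_, ?_⟩
  · obtain ⟨Ψ, hΨ⟩ := hψ k
    set x : generatedCStar (G k).algebra := ⟨w, subset_generatedCStar _ w.2⟩ with hx
    have h1 : x * star x * x = x := Subtype.ext hw.2.1
    have h2 : Ψ x * star (Ψ x) * Ψ x = Ψ x := by
      rw [← map_star, ← map_mul, ← map_mul, h1]
    rw [← hΨ]
    exact congrArg Subtype.val h2
  · have hclosed : IsClosed (C : Set D) := hC ▸ isClosed_closure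
    set v : D := ((ψ k w : A) : D) with hv
    have hcl : IsClosed {c : D | star v * c * v ∈ (C : Set D) ∧ v * c * star v ∈ (C : Set D)} :=
      (hclosed.preimage (by fun_prop)).inter (hclosed.preimage (by fun_prop))
    intro c hc
    rw [← SetLike.mem_coe, hC] at hc
    refine closure_minimal ?_ hcl hc
    intro x hx
    obtain ⟨j, a, ha, rfl⟩ := Set.mem_iUnion.1 hx
    -- At a common stage the conjugate of one diagonal element by one normaliser is diagonal, and
    -- the extension of `ψ` transports this to `C`.
    obtain ⟨w', hw1, hw2⟩ := hlift (max k j) (le_max_left _ _)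
    obtain ⟨c', hc1, hc2⟩ := hliftC j a ha (max k j) (le_max_right _ _)
    obtain ⟨Ψ, hΨ⟩ := hψ (max k j)
    have hn := hw1.2.2 _ hc1
    set y : generatedCStar (G (max k j)).algebra := ⟨w', subset_generatedCStar _ w'.2⟩ with hy
    set d : generatedCStar (G (max k j)).algebra := ⟨c', subset_generatedCStar _ c'.2⟩ with hd
    have hvy : v = Ψ y := by rw [hv, ← hw2, ← hΨ]
    have had : (ψ j a : D) = Ψ d := by rw [← hc2, ← hΨ]
    have h1 : ((Ψ (star y * d * y) : generatedCStar A) : D) ∈ C := by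
      have := hmem _ ⟨_, masa_le _ hn.1⟩ hn.1
      rw [← hΨ] at this
      exact this
    have h2 : ((Ψ (y * d * star y) : generatedCStar A) : D) ∈ C := by
      have := hmem _ ⟨_, masa_le _ hn.2⟩ hn.2
      rw [← hΨ] at this
      exact this
    rw [map_mul, map_mul, map_star] at h1 h2
    change star v * (ψ j a : D) * v ∈ C ∧ v * (ψ j a : D) * star v ∈ C
    rw [hvy, had]
    exact ⟨h1, h2⟩

/-- A building block of a regular limit, embedded in the limit algebra. -/
structure RegularStage (A : NonUnitalSubalgebra ℂ D) (C : NonUnitalStarSubalgebra ℂ D) where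
  graph : FiniteDigraph
  map : graph.algebra →ₙₐ[ℂ] A
  isRegularEmbedding : IsRegularEmbedding C map

/-- A sequence of regular embeddings approximating all of `A` can be made into a regular limit. -/
theorem isRegularLimit_of_approximation (hAC : IsOperatorAlgebraWithMasa A C)
    {a : ℕ → D} (haA : ∀ j, a j ∈ A) (hdense : (A : Set D) ⊆ closure (Set.range a))
    {G : ℕ → FiniteDigraph} {φ : ∀ k, (G k).algebra →ₙₐ[ℂ] A}
    (hφ : ∀ k, IsRegularEmbedding C (φ k))
    (hlim : ∀ a ∈ A, ∃ b : ∀ k, (G k).algebra, Tendsto (fun k => (φ k (b k) : D)) atTop (𝓝 a)) :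
    IsRegularLimitOfDigraphAlgebras A C := by
  have hstep : ∀ (S : RegularStage A C) (k : ℕ), ∃ (S' : RegularStage A C)
      (χ : S.graph.algebra →ₙₐ[ℂ] S'.graph.algebra), IsRegularEmbedding S'.graph.masa χ ∧
      (∀ x, S'.map (χ x) = S.map x) ∧
      ∀ j ≤ k, ∃ b, ‖a j - (S'.map b : D)‖ < 1 / ((k : ℝ) + 1) := by
    intro S k
    obtain ⟨H, ψ, χ, h1, h2, h3, h4⟩ := exists_extension hAC hφ hlim S.isRegularEmbedding
      (T := a '' Set.Iic k) ((Set.finite_Iic k).image a)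
      (by rintro _ ⟨j, -, rfl⟩; exact haA j) (Nat.one_div_pos_of_nat (α := ℝ) (n := k))
    exact ⟨⟨H, ψ, h1⟩, χ, h2, h3, fun j hj => h4 _ ⟨j, hj, rfl⟩⟩
  choose next χ hχ hχmap hnear using hstep
  -- Stage `k + 1` approximates `a 0, …, a k` to within `1 / (k + 1)`; hence the index `max j n + 1`
  -- below.
  let st : ℕ → RegularStage A C := fun n =>
    Nat.rec ⟨G 0, φ 0, hφ 0⟩ (fun k S => next S k) n
  have hApp : ∀ x ∈ A, ∀ ε : ℝ, 0 < ε → ∃ k, ∃ b, ‖x - ((st k).map b : D)‖ < ε := by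
    intro x hx ε hε
    obtain ⟨_, ⟨j, rfl⟩, hj⟩ := Metric.mem_closure_iff.1 (hdense hx) (ε / 2) (by positivity)
    obtain ⟨n, hn⟩ := exists_nat_one_div_lt (show 0 < ε / 2 by positivity)
    obtain ⟨b, hb⟩ := hnear (st (max j n)) (max j n) j (le_max_left _ _)
    refine ⟨max j n + 1, b, ?_⟩
    have h1 : 1 / (((max j n : ℕ) : ℝ) + 1) ≤ 1 / ((n : ℝ) + 1) := by
      gcongr
      exact le_max_right _ _
    rw [dist_eq_norm] at hj
    calc ‖x - ((st (max j n + 1)).map b : D)‖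
        ≤ ‖x - a j‖ + ‖a j - ((st (max j n + 1)).map b : D)‖ :=
          norm_sub_le_norm_sub_add_norm_sub _ _ _
      _ < ε := by
          have : ‖a j - ((st (max j n + 1)).map b : D)‖ < 1 / (((max j n : ℕ) : ℝ) + 1) := hb
          linarith
  refine ⟨fun k => (st k).graph, fun k => χ (st k) k, fun k => (st k).map, fun k => ?_,
    fun k => ?_, fun k x => hχmap (st k) k x, ?_, ?_⟩
  · exact ⟨(hχ (st k) k).injective, (hχ (st k) k).isStarExtendible, (hχ (st k) k).isRegular⟩
  · exact ⟨(st k).isRegularEmbedding.injective, (st k).isRegularEmbedding.isStarExtendible⟩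
  · refine Set.Subset.antisymm (fun x hx => ?_) (closure_minimal ?_ hAC.isClosed)
    · rw [Metric.mem_closure_iff]
      intro ε hε
      obtain ⟨k, b, hb⟩ := hApp x hx ε hε
      exact ⟨_, Set.mem_iUnion.2 ⟨k, b, rfl⟩, by rwa [dist_eq_norm]⟩
    · refine Set.iUnion_subset fun k => ?_
      rintro _ ⟨b, rfl⟩
      exact ((st k).map b).2
  · refine Set.Subset.antisymm (fun x hx => ?_) (closure_minimal ?_ hAC.isClosed_masa)
    · rw [Metric.mem_closure_iff]
      intro ε hε
      obtain ⟨k, b, hb⟩ := hApp x (hAC.masa_le x hx) (ε / 2) (by positivity)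
      obtain ⟨c, hc1, hc2⟩ := (st k).isRegularEmbedding.exists_masa_near hAC hx b
      refine ⟨_, Set.mem_iUnion.2 ⟨k, c, hc1, rfl⟩, ?_⟩
      rw [dist_eq_norm]
      linarith
    · refine Set.iUnion_subset fun k => ?_
      rintro _ ⟨b, hb, rfl⟩
      exact coe_map_masa_mem hAC (st k).isRegularEmbedding hb

/-- Distances to `R k` are 1-Lipschitz, so they tend to zero on the closure of the sequence. The
term `1 / (k + 1)` pays for choosing a point, as the infimum need not be attained. -/
lemma exists_tendsto_of_infDist {R : ℕ → Set D} (hR : ∀ k, (R k).Nonempty) {a : ℕ → D}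
    (ha : ∀ k, ∀ j ≤ k, Metric.infDist (a j) (R k) < 1 / ((k : ℝ) + 1)) {x : D}
    (hx : x ∈ closure (Set.range a)) :
    ∃ y : ℕ → D, (∀ k, y k ∈ R k) ∧ Tendsto y atTop (𝓝 x) := by
  have h1 : ∀ k, ∃ y ∈ R k, dist x y < Metric.infDist x (R k) + 1 / ((k : ℝ) + 1) := fun k =>
    (Metric.infDist_lt_iff (hR k)).1 (lt_add_of_pos_right _ Nat.one_div_pos_of_nat)
  choose y hy hyd using h1
  refine ⟨y, hy, Metric.tendsto_atTop.2 fun ε hε => ?_⟩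
  obtain ⟨_, ⟨j, rfl⟩, hj⟩ := Metric.mem_closure_iff.1 hx (ε / 3) (by positivity)
  obtain ⟨n, hn⟩ := exists_nat_one_div_lt (show 0 < ε / 3 by positivity)
  refine ⟨max j n, fun k hk => ?_⟩
  have h2 := ha k j ((le_max_left _ _).trans hk)
  have h3 : 1 / ((k : ℝ) + 1) ≤ 1 / ((n : ℝ) + 1) := by
    gcongr
    exact (le_max_right _ _).trans hk
  have h4 : Metric.infDist x (R k) ≤ Metric.infDist (a j) (R k) + dist x (a j) :=
    Metric.infDist_le_infDist_add_dist
  rw [dist_comm]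
  linarith [hyd k]

end Characterisation

theorem theorem3p11 {D : Type u} [NonUnitalCStarAlgebra D]
    (A : NonUnitalSubalgebra ℂ D) (C : NonUnitalStarSubalgebra ℂ D)
    (hAC : IsOperatorAlgebraWithMasa A C) (hA : TopologicalSpace.IsSeparable (A : Set D)) :
    IsRegularLimitOfDigraphAlgebras A C ↔
      ∀ ε : ℝ, 0 < ε → ∀ S : Set D, S.Finite → S ⊆ (A : Set D) →
        ∃ (G : FiniteDigraph) (φ : G.algebra →ₙₐ[ℂ] A),
          Function.Injective φ ∧ IsStarExtendible φ ∧ IsRegularMap G.masa C φ ∧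
          ∀ s ∈ S, Metric.infDist s {x : D | ∃ b : G.algebra, (φ b : D) = x} < ε := by
  constructor
  · rintro ⟨G, φ, ψ, hφ, hψ, hcomp, hAcl, hCcl⟩ ε hε S hS hSA
    have hev : ∀ᶠ m in Filter.atTop, ∀ s ∈ S,
        Metric.infDist s {x : D | ∃ b : (G m).algebra, (ψ m b : D) = x} < ε := by
      refine hS.eventually_all.2 fun s hs => ?_
      have hs' := hSA hs
      rw [hAcl] at hs'
      obtain ⟨x, hx, hsx⟩ := Metric.mem_closure_iff.1 hs' ε hε
      obtain ⟨k, b, rfl⟩ := Set.mem_iUnion.1 hx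
      filter_upwards [Filter.eventually_ge_atTop k] with m hm
      have hlift : ∃ b' : (G m).algebra, ψ m b' = ψ k b := by
        induction m, hm using Nat.le_induction with
        | base => exact ⟨b, rfl⟩
        | succ m _ ih =>
          obtain ⟨b', hb'⟩ := ih
          exact ⟨φ m b', by rw [hcomp, hb']⟩
      obtain ⟨b', hb'⟩ := hlift
      have hmem : (ψ k b : D) ∈ {x : D | ∃ b : (G m).algebra, (ψ m b : D) = x} :=
        ⟨b', by rw [hb']⟩
      exact (Metric.infDist_le_dist_of_mem hmem).trans_lt hsx
    obtain ⟨m, hm⟩ := hev.exists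
    exact ⟨G m, ψ m, (hψ m).1, (hψ m).2,
      isRegularMap_of_limit (fun k => ⟨(hφ k).1, (hφ k).2.1, (hφ k).2.2⟩)
        (fun k => (hψ k).2) hcomp hCcl m, hm⟩
  · intro h
    obtain ⟨t, htA, htc, htd⟩ := hA.exists_countable_dense_subset
    have htne : t.Nonempty := closure_nonempty_iff.1 ⟨0, htd (zero_mem A)⟩
    obtain ⟨a, rfl⟩ := htc.exists_eq_range htne
    have haA : ∀ j, a j ∈ A := fun j => htA ⟨j, rfl⟩
    -- The `k`-th embedding handles the first `k + 1` terms of the dense sequence to within `1 / (k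
    -- + 1)`; no relation between different `k` is available yet.
    choose G φ h1 h2 h3 h4 using fun k : ℕ => h (1 / ((k : ℝ) + 1)) Nat.one_div_pos_of_nat
      (a '' Set.Iic k) ((Set.finite_Iic k).image a) (by rintro _ ⟨j, -, rfl⟩; exact haA j)
    refine isRegularLimit_of_approximation hAC haA htd (fun k => ⟨h1 k, h2 k, h3 k⟩)
      fun x hx => ?_
    obtain ⟨y, hy, hylim⟩ := exists_tendsto_of_infDist
      (R := fun k => {x : D | ∃ b : (G k).algebra, (φ k b : D) = x}) (fun k => ⟨_, 0, rfl⟩)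
      (fun k j hj => h4 k _ ⟨j, hj, rfl⟩) (htd hx)
    choose b hb using hy
    exact ⟨b, by simpa only [hb] using hylim⟩
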